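/- Throughout, let $G$ be an abelian group and $n\ge 3$. A $G$-$n$-tuple is $\vec d=(d_1,\dots,d_n)\in G^n$ with $\sum_i d_i=0$; put $\vec d(I)=\sum_{i\in I}d_i$ for $I\subset[n]=\{1,\dots,n\}$. A function $f\colon G\to\mathbb{Q}$ is symmetric if $f(-a)=f(a)$ for all $a$, and a symmetric $f$ is F-nef if $f(a)+f(b)+f(c)+f(a+b+c)\ge f(a+b)+f(a+c)+f(b+c)$ for all $a,b,c\in G$. A weighting is a function $w$ from the edges $i\sim j$ of the complete graph on $[n]$ to $\mathbb{Q}$; put $w(i)=\sum_{j\ne i}w(i\sim j)$ and, for a partition $I\sqcup J=[n]$ into two non-empty parts, $w(I\mid J)=\sum_{i\in I,\,j\in J}w(i\sim j)$. The partition is proper if $|I|,|J|\ge 2$. For a symmetric $f$ and a $G$-$n$-tuple $\vec d$, consider the conditions on $w$: (a) $w(i)=f(d_i)$ for all $i$; (b) $w(I\mid J)\ge f(\vec d(I))$ for all proper partitions $I\sqcup J=[n]$. - $f$ is effective with respect to $\vec d$ if some weighting satisfies (a) and (b). - An $[n]$-labeled tree is a finite tree whose leaves are labeled bijectively by $[n]$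 and all of whose other nodes have valence at least $3$; its $T$-partitions are the partitions $I\sqcup J=[n]$ of the leaves obtained by deleting one edge (edges at leaves included). For such a tree $T$, $f$ is $T$-effective with respect to $\vec d$ if some weighting satisfies (a), (b) and $w(I\mid J)=f(\vec d(I))$ for all $T$-partitions $I\sqcup J$. - $f$ is cyclically effective with respect to $\vec d$ if for every bijection $\sigma$ from $[n]$ to the vertices of a regular $n$-gon some weighting satisfies (a), (b) and $w(I\mid J)=f(\vec d(I))$ for all partitions $I\sqcup J=[n]$ such that $\sigma(I)$ is a set of contiguous vertices. A symmetric $f$ is effective (respectively, cyclically effective) if it is so with respect to every $G$-$n$-tuple for every $n\ge3$. Proposition. Let $m\ge 3$ and let $f\colon\mathbb{Z}_m\to\mathbb{Q}$ be a symmetric function with $f(0)=0$ that is cyclically effective and F-nef. Put \[ m(f)=\tfrac12\min\{2f(a)+2f(b)-f(a+b)-f(a-b)\mid a,b\in\mathbb{Z}_m\setminus\{0\}\}, \] let $\widetilde f(0)=m(f)$ and $\widetilde f(k)=f(k)$ for $k\ne0$, and let \[ Q_f(x_0,\dots,x_{m-1})=\sum_{0\le i,j\le m-1}q_f(i-j)\,x_ix_j,\qquad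 q_f(a)=\tfrac12\bigl(f(a+1)+f(a-1)-2f(a)\bigr). \] Suppose that $Q_f(x)\ge m(f)$ for every non-zero $x\in\mathbb{Z}^m$ with $\sum_i x_i=0$. Then $\widetilde f$ is effective. Moreover, for every $n\ge3$, every $\mathbb{Z}_m$-$n$-tuple $\vec d$ and every $[n]$-labeled tree $T$ all of whose $T$-partitions $I\sqcup J=[n]$ satisfy $\vec d(I)\ne0$ in $\mathbb{Z}_m$, the function $\widetilde f$ is $T$-effective with respect to $\vec d$. -/

import Mathlib

namespace M0n

/-! ### Symmetric and F-nef functions on an abelian group -/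

/-- A function on an abelian group is symmetric if `f (-a) = f a`. -/
def IsSymm {G : Type*} [AddCommGroup G] (f : G → ℚ) : Prop :=
  ∀ a, f (-a) = f a

/-- F-nef functions. -/
def IsFNef {G : Type*} [AddCommGroup G] (f : G → ℚ) : Prop :=
  IsSymm f ∧ ∀ a b c, f (a + b) + f (a + c) + f (b + c) ≤ f a + f b + f c + f (a + b + c)

/-! ### Weightings of the complete graph on `[n]` -/

/-- A weighting of the complete graph on `Fin n`; the weight of the edge `i ∼ j` is `w s(i, j)`.
The values on the diagonal of `Sym2 (Fin n)` are never used. -/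
abbrev Weighting (n : ℕ) := Sym2 (Fin n) → ℚ

/-- The flow through a vertex. -/
def vertexFlow {n : ℕ} (w : Weighting n) (k : Fin n) : ℚ :=
  ∑ i ∈ Finset.univ.erase k, w s(k, i)

/-- The flow across the partition `I ⊔ Iᶜ` of `[n]`. -/
def flow {n : ℕ} (w : Weighting n) (I : Finset (Fin n)) : ℚ :=
  ∑ i ∈ I, ∑ j ∈ Iᶜ, w s(i, j)

/-- The partition `I ⊔ Iᶜ` of `[n]` is proper: both parts have at least two elements. -/
def IsProper {n : ℕ} (I : Finset (Fin n)) : Prop :=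
  2 ≤ I.card ∧ 2 ≤ Iᶜ.card

/-- Conditions (a), (b) common to all notions of effectivity of `f` with respect to `d`: the flow
through each vertex `i` is `f (d i)`, the flow across each proper partition `I ⊔ J` is at
least `f (d(I))`, where `d(I) = ∑ i ∈ I, d i`. -/
def IsAdmissible {G : Type*} [AddCommGroup G] (f : G → ℚ) {n : ℕ} (d : Fin n → G)
    (w : Weighting n) : Prop :=
  (∀ i, vertexFlow w i = f (d i)) ∧ ∀ I, IsProper I → f (∑ i ∈ I, d i) ≤ flow w I

/-! ### Effectivity -/

/-- `f` is effective with respect to `d`. -/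
def EffectiveWrt {G : Type*} [AddCommGroup G] (f : G → ℚ) {n : ℕ} (d : Fin n → G) : Prop :=
  ∃ w : Weighting n, IsAdmissible f d w

/-- `f` is effective: for all `n ≥ 3`, it is effective with respect to every `n`-tuple `d` of
elements of `G` with sum zero. -/
def IsEffective {G : Type*} [AddCommGroup G] (f : G → ℚ) : Prop :=
  IsSymm f ∧ ∀ n : ℕ, 3 ≤ n → ∀ d : Fin n → G, ∑ i, d i = 0 → EffectiveWrt f d

/-- For a cyclic ordering of `[n]`, represented by a bijection `σ` with the vertices `ZMod n` of the
regular `n`-gon: the partition `I ⊔ Iᶜ` (with non-empty parts) is `σ`-contiguous if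
`σ(I) = {s, s + 1, …, s + k - 1}` for some `s` and `k`.
This is unchanged when `σ` is composed with a rotation. -/
def IsContiguous {n : ℕ} (σ : Fin n ≃ ZMod n) (I : Finset (Fin n)) : Prop :=
  I.Nonempty ∧ Iᶜ.Nonempty ∧
    ∃ (s : ZMod n) (k : ℕ), ∀ i, i ∈ I ↔ ∃ j : ℕ, j < k ∧ σ i = s + (j : ZMod n)

/-- `f` is cyclically effective with respect to `d`. -/
def CyclicallyEffectiveWrt {G : Type*} [AddCommGroup G] (f : G → ℚ) {n : ℕ} (d : Fin n → G) :
    Prop :=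
  ∀ σ : Fin n ≃ ZMod n, ∃ w : Weighting n, IsAdmissible f d w ∧
    ∀ I, IsContiguous σ I → flow w I = f (∑ i ∈ I, d i)

/-- `f` is cyclically effective. -/
def IsCyclicallyEffective {G : Type*} [AddCommGroup G] (f : G → ℚ) : Prop :=
  IsSymm f ∧ ∀ n : ℕ, 3 ≤ n → ∀ d : Fin n → G, ∑ i, d i = 0 → CyclicallyEffectiveWrt f d

/-- `T` with the labelling `leaf` is an `[n]`-labeled tree: a finite tree whose leaves (the
vertices of valence one) are labeled bijectively by `[n]`, and all of whose other vertices have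
valence at least three. -/
structure IsLabeledTree {V : Type*} {n : ℕ} (T : SimpleGraph V) (leaf : Fin n → V) : Prop where
  finite : Finite V
  isTree : T.IsTree
  leaf_injective : Function.Injective leaf
  leaf_iff : ∀ v, (T.neighborSet v).ncard = 1 ↔ v ∈ Set.range leaf
  internal : ∀ v, v ∉ Set.range leaf → 3 ≤ (T.neighborSet v).ncard

/-- `I ⊔ Iᶜ` is a `T`-partition: for some edge `u ∼ v` of `T`, `I` is the set of (labels of)
leaves in the component of `u` after deletion of that edge. -/
def IsTreePartition {V : Type*} {n : ℕ} (T : SimpleGraph V) (leaf : Fin n → V)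
    (I : Finset (Fin n)) : Prop :=
  ∃ u v, T.Adj u v ∧ ∀ i, i ∈ I ↔ (T.deleteEdges {s(u, v)}).Reachable u (leaf i)

/-- `f` is `T`-effective with respect to `d`. -/
def TreeEffectiveWrt {V : Type*} {n : ℕ} (T : SimpleGraph V) (leaf : Fin n → V)
    {G : Type*} [AddCommGroup G] (f : G → ℚ) (d : Fin n → G) : Prop :=
  ∃ w : Weighting n, IsAdmissible f d w ∧
    ∀ I, IsTreePartition T leaf I → flow w I = f (∑ i ∈ I, d i)

/-! ### The modified function and the quadratic form -/

/-- `m(f)`: half of the minimum of `2 f(a) + 2 f(b) - f(a + b) - f(a - b)` over non-zero `a, b`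
(and `0` by convention for the trivial group, where there are no such pairs). -/
def minVal {G : Type*} [AddCommGroup G] [Fintype G] [DecidableEq G] (f : G → ℚ) : ℚ :=
  if h : (Finset.univ.filter fun p : G × G => p.1 ≠ 0 ∧ p.2 ≠ 0).Nonempty then
    (1 / 2) * (Finset.univ.filter fun p : G × G => p.1 ≠ 0 ∧ p.2 ≠ 0).inf' h
      fun p => 2 * f p.1 + 2 * f p.2 - f (p.1 + p.2) - f (p.1 - p.2)
  else 0

theorem isLeast_minVal {G : Type*} [AddCommGroup G] [Fintype G] [DecidableEq G] [Nontrivial G]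
    (f : G → ℚ) :
    IsLeast {x : ℚ | ∃ a b : G, a ≠ 0 ∧ b ≠ 0 ∧
      x = (1 / 2) * (2 * f a + 2 * f b - f (a + b) - f (a - b))} (minVal f) := by
  obtain ⟨g, hg⟩ := exists_ne (0 : G)
  have h : (Finset.univ.filter fun p : G × G => p.1 ≠ 0 ∧ p.2 ≠ 0).Nonempty :=
    ⟨(g, g), by simp [hg]⟩
  rw [minVal, dif_pos h]
  constructor
  · obtain ⟨p, hp, he⟩ := Finset.exists_mem_eq_inf' h
      (fun p : G × G => 2 * f p.1 + 2 * f p.2 - f (p.1 + p.2) - f (p.1 - p.2))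
    rw [Finset.mem_filter] at hp
    exact ⟨p.1, p.2, hp.2.1, hp.2.2, by rw [he]⟩
  · rintro x ⟨a, b, ha, hb, rfl⟩
    have := Finset.inf'_le
      (fun p : G × G => 2 * f p.1 + 2 * f p.2 - f (p.1 + p.2) - f (p.1 - p.2))
      (show (a, b) ∈ Finset.univ.filter fun p : G × G => p.1 ≠ 0 ∧ p.2 ≠ 0 by simp [ha, hb])
    exact mul_le_mul_of_nonneg_left this (by norm_num)

/-- The function that agrees with `f` away from `0` and has value `m(f)` at `0`. -/
def tilde {G : Type*} [AddCommGroup G] [Fintype G] [DecidableEq G] (f : G → ℚ) : G → ℚ :=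
  fun k => if k = 0 then minVal f else f k

/-- `q_f(a) = (f(a + 1) + f(a - 1) - 2 f(a)) / 2`. -/
def secondDiff {m : ℕ} (f : ZMod m → ℚ) (a : ZMod m) : ℚ :=
  (1 / 2) * (f (a + 1) + f (a - 1) - 2 * f a)

/-- The quadratic form `Q_f(x) = ∑ q_f(i - j) x_i x_j` associated to `f`, with the variables
`x_0, …, x_{m-1}` indexed by `ZMod m`. -/
def quadForm {m : ℕ} [NeZero m] (f : ZMod m → ℚ) (x : ZMod m → ℚ) : ℚ :=
  ∑ i, ∑ j, secondDiff f (i - j) * x i * x j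

end M0n

namespace M0n

/-! ### The energy form of a function on `ZMod m` -/

section Energy

variable {m : ℕ} [NeZero m]

/-! Fix an ordering of the labels and follow the closed path of partial sums of `d` in `ZMod m`.
Label `i` runs along an arc, viewed as end point minus start point. Let `E` be the bilinear form
with kernel `-f (u - v) / 2`. The cyclic weighting for this ordering is forced: the weight of `i ∼
j` is `-E(arc_i, arc_j)`. As all the arcs add up to zero, the flow across `I` is `E(c, c)`, with `c`
the sum of the arcs labeled by `I` (`flow_eq_energyForm`).

If `d(I) = 0`, then `c` has total mass zero and first moment zero, so it is a translate minus the
original of an integral vector `x` of mass zero, and `E(c, c) = Q_f(x)`. By hypothesis this is at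
least `minVal f` unless `c = 0` (`minVal_le_energyForm`). One cyclic weighting thus fails only where
`c` vanishes, and averaging over suitable orderings repairs this.

The orderings come from a rooted tree whose nodes all have non-zero sums: binary nodes are flipped,
ternary ones rotated. Take a node that `I` splits while splitting none of its children. Flipping two
children with sums `a, b` changes `c` by a vector of energy `2f(a) + 2f(b) - f(a+b) - f(a-b) ≥ 2 *
minVal f`. So if `c` vanishes for one order, the other order compensates. Ternary nodes have three
children of equal sum `h` with `2h = 0`, and the bound `minVal f ≤ f h` does the same job
(`minVal_le_avg_energyForm`).

Such a tree exists because a maximal laminar family of sets with non-zero sums has only nodes of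
these two kinds (`exists_tree_of_maximal`). Started from the partitions of a given labeled tree, it
keeps the flow across them exact: every block is a segment of every ordering used. Zero labels,
which occur only for plain effectivity, are inserted afterwards by subdividing an edge. -/

/-- The symmetric bilinear form on integral vectors with kernel `-f (u - v) / 2`. -/
def energyForm (f : ZMod m → ℚ) (x y : ZMod m → ℤ) : ℚ :=
  -(1 / 2) * ∑ u, ∑ v, f (u - v) * x u * y v

/-- The arc from `p` to `p + a`, as a difference of point masses. -/
def arc (p a : ZMod m) : ZMod m → ℤ := Pi.single (p + a) 1 - Pi.single p 1

theorem energyForm_add_left (f : ZMod m → ℚ) (x x' y : ZMod m → ℤ) :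
    energyForm f (x + x') y = energyForm f x y + energyForm f x' y := by
  simp only [energyForm, Pi.add_apply, Int.cast_add, mul_add, add_mul, Finset.sum_add_distrib]

theorem energyForm_add_right (f : ZMod m → ℚ) (x y y' : ZMod m → ℤ) :
    energyForm f x (y + y') = energyForm f x y + energyForm f x y' := by
  simp only [energyForm, Pi.add_apply, Int.cast_add, mul_add, Finset.sum_add_distrib]

theorem energyForm_sub_left (f : ZMod m → ℚ) (x x' y : ZMod m → ℤ) :
    energyForm f (x - x') y = energyForm f x y - energyForm f x' y := by
  rw [eq_sub_iff_add_eq, ← energyForm_add_left, sub_add_cancel]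

theorem energyForm_sub_right (f : ZMod m → ℚ) (x y y' : ZMod m → ℤ) :
    energyForm f x (y - y') = energyForm f x y - energyForm f x y' := by
  rw [eq_sub_iff_add_eq, ← energyForm_add_right, sub_add_cancel]

theorem energyForm_zero_left (f : ZMod m → ℚ) (y : ZMod m → ℤ) : energyForm f 0 y = 0 := by
  simp [energyForm]

theorem energyForm_zero_right (f : ZMod m → ℚ) (y : ZMod m → ℤ) : energyForm f y 0 = 0 := by
  simp [energyForm]

theorem energyForm_sum_left (f : ZMod m → ℚ) {ι : Type*} (s : Finset ι) (x : ι → ZMod m → ℤ)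
    (y : ZMod m → ℤ) : energyForm f (∑ i ∈ s, x i) y = ∑ i ∈ s, energyForm f (x i) y := by
  classical
  induction s using Finset.induction_on with
  | empty => simp [energyForm_zero_left]
  | insert a s ha ih => simp [Finset.sum_insert ha, energyForm_add_left, ih]

theorem energyForm_sum_right (f : ZMod m → ℚ) {ι : Type*} (s : Finset ι) (x : ι → ZMod m → ℤ)
    (y : ZMod m → ℤ) : energyForm f y (∑ i ∈ s, x i) = ∑ i ∈ s, energyForm f y (x i) := by
  classical
  induction s using Finset.induction_on with
  | empty => simp [energyForm_zero_right]
  | insert a s ha ih => simp [Finset.sum_insert ha, energyForm_add_right, ih]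

theorem energyForm_comm {f : ZMod m → ℚ} (hf : IsSymm f) (x y : ZMod m → ℤ) :
    energyForm f x y = energyForm f y x := by
  unfold energyForm
  rw [Finset.sum_comm]
  congr 1
  refine Finset.sum_congr rfl fun u _ => Finset.sum_congr rfl fun v _ => ?_
  rw [← hf (v - u), neg_sub]; ring

theorem energyForm_neg_neg (f : ZMod m → ℚ) (x y : ZMod m → ℤ) :
    energyForm f (-x) (-y) = energyForm f x y := by
  simp [energyForm]

theorem energyForm_single (f : ZMod m → ℚ) (a b : ZMod m) :
    energyForm f (Pi.single a 1) (Pi.single b 1) = -(1 / 2) * f (a - b) := by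
  unfold energyForm
  rw [Finset.sum_eq_single a, Finset.sum_eq_single b]
  · simp
  · intro v _ hv; simp [Pi.single_eq_of_ne hv]
  · simp
  · intro v _ hv; simp [Pi.single_eq_of_ne hv]
  · simp

theorem energyForm_arc (f : ZMod m → ℚ) (p a q b : ZMod m) :
    energyForm f (arc p a) (arc q b) =
      -(1 / 2) * (f (p + a - (q + b)) - f (p + a - q) - f (p - (q + b)) + f (p - q)) := by
  simp only [arc, energyForm_sub_left, energyForm_sub_right, energyForm_single]
  ring

/-- When adjacent arcs of lengths `a` and `b` trade places, the first one moves from `p` to `p + b`.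
The energy of this change is exactly the expression minimized in `minVal`. -/
theorem energyForm_rectangle {f : ZMod m → ℚ} (hf : IsSymm f) (hf0 : f 0 = 0) (p a b : ZMod m) :
    energyForm f (arc (p + b) a - arc p a) (arc (p + b) a - arc p a) =
      2 * f a + 2 * f b - f (a + b) - f (a - b) := by
  simp only [energyForm_sub_left, energyForm_sub_right, energyForm_arc]
  have e1 : p + b + a - (p + b + a) = 0 := by abel
  have e2 : p + b + a - (p + b) = a := by abel
  have e3 : p + b - (p + b + a) = -a := by abel
  have e4 : p + b - (p + b) = 0 := by abel
  have e5 : p + b + a - (p + a) = b := by abel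
  have e6 : p + b + a - p = a + b := by abel
  have e7 : p + b - (p + a) = -(a - b) := by abel
  have e8 : p + b - p = b := by abel
  have e9 : p + a - (p + b + a) = -b := by abel
  have e10 : p + a - (p + b) = a - b := by abel
  have e11 : p - (p + b + a) = -(a + b) := by abel
  have e12 : p - (p + b) = -b := by abel
  have e13 : p + a - (p + a) = 0 := by abel
  have e14 : p + a - p = a := by abel
  have e15 : p - (p + a) = -a := by abel
  have e16 : p - p = 0 := by abel
  rw [e1, e2, e3, e4, e5, e6, e7, e8, e9, e10, e11, e12, e13, e14, e15, e16]
  simp only [hf _, hf0]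
  ring

/-- An integral vector of total mass zero whose first moment vanishes modulo `m` is the difference
of a vector of total mass zero and its translate. -/
theorem exists_translate_sub (y : ZMod m → ℤ) (hy : ∑ u, y u = 0)
    (hmom : ∑ u, (y u : ZMod m) * u = 0) :
    ∃ x : ZMod m → ℤ, ∑ u, x u = 0 ∧ ∀ u, y u = x (u - 1) - x u := by
  classical
  have hm : 0 < m := Nat.pos_of_ne_zero (NeZero.ne m)
  have key : ∃ x : ZMod m → ℤ, ∀ u, y u = x (u - 1) - x u := by
    -- Minus the partial sums of `y`, starting at `0`; the relation closes up at `u = 0` because `y`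
    -- has total mass zero.
    refine ⟨fun u => -∑ v ∈ Finset.univ.filter (fun v : ZMod m => v.val ≤ u.val), y v, fun u => ?_⟩
    by_cases hu : u = 0
    · subst hu
      have h1 : (Finset.univ.filter fun v : ZMod m => v.val ≤ (0 - 1 : ZMod m).val)
          = Finset.univ := by
        refine Finset.filter_true_of_mem fun v _ => ?_
        obtain ⟨k, rfl⟩ : ∃ k, m = k + 1 := ⟨m - 1, by omega⟩
        rw [zero_sub, ZMod.val_neg_one]
        exact Nat.lt_succ_iff.mp (ZMod.val_lt v)
      have h2 : (Finset.univ.filter fun v : ZMod m => v.val ≤ (0 : ZMod m).val) = {0} := by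
        ext v; simp
      simp only [h1, h2, hy, Finset.sum_singleton]; ring
    · have hv : (u - 1).val + 1 = u.val := by
        have hpos : 0 < u.val := Nat.pos_of_ne_zero fun h => hu ((ZMod.val_eq_zero u).mp h)
        have hlt := ZMod.val_lt u
        have : u - 1 = ((u.val - 1 : ℕ) : ZMod m) := by
          rw [Nat.cast_sub hpos]; simp
        rw [this, ZMod.val_natCast, Nat.mod_eq_of_lt (by omega)]; omega
      have h1 : (Finset.univ.filter fun v : ZMod m => v.val ≤ u.val)
          = insert u (Finset.univ.filter fun v : ZMod m => v.val ≤ (u - 1).val) := by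
        ext v
        simp only [Finset.mem_filter, Finset.mem_univ, true_and, Finset.mem_insert]
        constructor
        · intro h
          rcases h.eq_or_lt with h | h
          · exact Or.inl (ZMod.val_injective m h)
          · right; omega
        · rintro (rfl | h)
          · exact le_rfl
          · omega
      simp only [h1]
      rw [Finset.sum_insert (by simp; omega)]
      ring
  obtain ⟨x, hx⟩ := key
  -- Summation by parts identifies the mass of `x` modulo `m` with the first moment of `y`. The mass
  -- is thus a multiple `m * c`, and subtracting the constant `c` removes it without changing
  -- differences.
  have hsum : ((∑ u, x u : ℤ) : ZMod m) = 0 := by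
    have h1 : ∑ u, ((x (u - 1) : ℤ) : ZMod m) * u = ∑ u, ((x u : ℤ) : ZMod m) * (u + 1) := by
      rw [← Equiv.sum_comp (Equiv.addRight (1 : ZMod m))]
      simp
    have h2 : ∑ u, ((y u : ℤ) : ZMod m) * u = ∑ u, ((x u : ℤ) : ZMod m) := by
      simp only [hx, Int.cast_sub, sub_mul, Finset.sum_sub_distrib, h1, mul_add, mul_one,
        Finset.sum_add_distrib]
      ring
    rw [Int.cast_sum, ← h2, hmom]
  obtain ⟨c, hc⟩ := (ZMod.intCast_zmod_eq_zero_iff_dvd _ _).mp hsum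
  refine ⟨fun u => x u - c, ?_, fun u => by rw [hx]; ring⟩
  rw [Finset.sum_sub_distrib, hc]
  simp [ZMod.card]

/-- The kernel is translation invariant, so applying a difference to both arguments replaces `-f /
2` by the second difference of `f`. -/
theorem quadForm_eq_energyForm (f : ZMod m → ℚ) (x : ZMod m → ℤ) :
    quadForm f (fun u => (x u : ℚ)) =
      energyForm f (fun u => x (u - 1) - x u) (fun u => x (u - 1) - x u) := by
  have e : (fun u => x (u - 1) - x u) = (fun u => x (u - 1)) - x := rfl
  have h11 : energyForm f (fun u => x (u - 1)) (fun u => x (u - 1)) = energyForm f x x := by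
    unfold energyForm
    congr 1
    rw [← Equiv.sum_comp (Equiv.addRight (1 : ZMod m))]
    refine Finset.sum_congr rfl fun u _ => ?_
    rw [← Equiv.sum_comp (Equiv.addRight (1 : ZMod m))]
    simp
  have h12 : energyForm f (fun u => x (u - 1)) x =
      -(1 / 2) * ∑ u, ∑ v, f (u - v + 1) * x u * x v := by
    unfold energyForm
    congr 1
    rw [← Equiv.sum_comp (Equiv.addRight (1 : ZMod m))]
    refine Finset.sum_congr rfl fun u _ => Finset.sum_congr rfl fun v _ => ?_
    simp only [Equiv.coe_addRight, add_sub_cancel_right]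
    rw [add_sub_right_comm]
  have h21 : energyForm f x (fun u => x (u - 1)) =
      -(1 / 2) * ∑ u, ∑ v, f (u - v - 1) * x u * x v := by
    unfold energyForm
    congr 1
    refine Finset.sum_congr rfl fun u _ => ?_
    rw [← Equiv.sum_comp (Equiv.addRight (1 : ZMod m))]
    refine Finset.sum_congr rfl fun v _ => ?_
    simp only [Equiv.coe_addRight, add_sub_cancel_right]
    rw [sub_add_eq_sub_sub]
  rw [e, energyForm_sub_left, energyForm_sub_right, energyForm_sub_right, h11, h12, h21]
  simp only [energyForm, quadForm, secondDiff, Finset.mul_sum]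
  simp only [← Finset.sum_sub_distrib]
  refine Finset.sum_congr rfl fun u _ => Finset.sum_congr rfl fun v _ => ?_
  ring

theorem minVal_le_energyForm {f : ZMod m → ℚ}
    (hQ : ∀ x : ZMod m → ℤ, x ≠ 0 → ∑ i, x i = 0 → minVal f ≤ quadForm f (fun i => (x i : ℚ)))
    (y : ZMod m → ℤ) (hy : ∑ u, y u = 0) (hmom : ∑ u, (y u : ZMod m) * u = 0) (hne : y ≠ 0) :
    minVal f ≤ energyForm f y y := by
  obtain ⟨x, hx, hxy⟩ := exists_translate_sub y hy hmom
  have h : y = fun u => x (u - 1) - x u := funext hxy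
  rw [h, ← quadForm_eq_energyForm]
  refine hQ x (fun h0 => hne ?_) hx
  rw [h, h0]; rfl

end Energy

/-! ### Bounds involving the minimum value -/

section MinVal

variable {G : Type*} [AddCommGroup G] [Fintype G] [DecidableEq G] [Nontrivial G]

theorem two_mul_minVal_le (f : G → ℚ) {a b : G} (ha : a ≠ 0) (hb : b ≠ 0) :
    2 * minVal f ≤ 2 * f a + 2 * f b - f (a + b) - f (a - b) := by
  have := (isLeast_minVal f).2 ⟨a, b, ha, hb, rfl⟩
  linarith

/-- The F-inequality for `a, b, -a`, taken at a minimizing pair. -/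
theorem minVal_nonneg {f : G → ℚ} (hf0 : f 0 = 0) (hf : IsFNef f) : 0 ≤ minVal f := by
  obtain ⟨a, b, -, -, h⟩ := (isLeast_minVal f).1
  have h1 := hf.2 a b (-a)
  rw [add_neg_cancel, hf0, hf.1 a, show a + b + -a = b by abel,
    show b + -a = -(a - b) by abel, hf.1 (a - b)] at h1
  rw [h]; linarith

/-- For `b` outside `{0, h}`, add the bounds for the pairs `(h, b)` and `(h, b + h)`: the terms in
`b` and `b + h` cancel and leave `4 * minVal f ≤ 4 * f h`. Such a `b` exists since the group has
more than two elements. -/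
theorem minVal_le_of_two_torsion {f : G → ℚ} (hf : IsSymm f) (hG : 2 < Fintype.card G) {h : G}
    (h0 : h ≠ 0) (h2 : h + h = 0) : minVal f ≤ f h := by
  obtain ⟨b, hb⟩ : ∃ b : G, b ∉ ({0, h} : Finset G) := by
    by_contra! hall
    have : Fintype.card G ≤ ({0, h} : Finset G).card :=
      Finset.card_le_card fun x _ => hall x
    exact absurd (this.trans Finset.card_le_two) (by omega)
  simp only [Finset.mem_insert, Finset.mem_singleton, not_or] at hb
  have hn : -h = h := neg_eq_of_add_eq_zero_left h2
  have k1 := two_mul_minVal_le f h0 hb.1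
  have k2 := two_mul_minVal_le f h0 (b := b + h) fun e => hb.2 <| by
    rw [eq_neg_of_add_eq_zero_left e, hn]
  have e1 : h - b = -(h + b) := by rw [neg_add, hn]; abel
  have e2 : h + (b + h) = b := by rw [add_left_comm, h2, add_zero]
  have e3 : h - (b + h) = -b := by abel
  rw [e1, hf] at k1
  rw [e2, e3, hf, add_comm b h] at k2
  linarith

end MinVal

/-! ### Cut functions of weightings -/

section Flow

variable {n : ℕ}

theorem flow_compl (w : Weighting n) (I : Finset (Fin n)) : flow w Iᶜ = flow w I := by
  unfold flow
  rw [compl_compl, Finset.sum_comm]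
  exact Finset.sum_congr rfl fun i _ => Finset.sum_congr rfl fun j _ => by rw [Sym2.eq_swap]

theorem flow_empty (w : Weighting n) : flow w ∅ = 0 := by simp [flow]

theorem flow_univ (w : Weighting n) : flow w Finset.univ = 0 := by simp [flow]

theorem vertexFlow_eq_flow (w : Weighting n) (k : Fin n) : vertexFlow w k = flow w {k} := by
  simp only [vertexFlow, flow, Finset.sum_singleton]
  refine Finset.sum_congr ?_ fun _ _ => rfl
  ext; simp

/-- The weight of an edge recovered from the cut function. -/
theorem two_mul_weight (w : Weighting n) {A : Finset (Fin n)} {i j : Fin n} (hi : i ∉ A)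
    (hj : j ∉ A) (hij : i ≠ j) :
    2 * w s(i, j) = flow w (insert i A) + flow w (insert j A) - flow w (insert i (insert j A))
      - flow w A := by
  obtain ⟨R, hR⟩ : ∃ R, R = (insert i (insert j A))ᶜ := ⟨_, rfl⟩
  have hiR : i ∉ R := by simp [hR]
  have hjR : j ∉ R := by simp [hR]
  have c1 : (insert i A)ᶜ = insert j R := by
    ext x; simp only [hR, Finset.mem_compl, Finset.mem_insert, not_or]
    by_cases hx : x = j <;> simp [hx, hj, hij.symm]
  have c2 : (insert j A)ᶜ = insert i R := by
    ext x; simp only [hR, Finset.mem_compl, Finset.mem_insert, not_or]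
    by_cases hx : x = i <;> simp [hx, hi, hij]
  have c3 : Aᶜ = insert i (insert j R) := by
    ext x; simp only [hR, Finset.mem_compl, Finset.mem_insert, not_or]
    by_cases hx : x = i
    · simp [hx, hi]
    · by_cases hx' : x = j <;> simp [hx, hx', hj]
  have hi' : i ∉ insert j A := by simp [hij, hi]
  have hi'' : i ∉ insert j R := by simp [hij, hiR]
  have hs : ∀ (k : Fin n) (B : Finset (Fin n)), ∑ x ∈ B, w s(k, x) = ∑ x ∈ B, w s(x, k) :=
    fun k B => Finset.sum_congr rfl fun x _ => by rw [Sym2.eq_swap]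
  simp only [flow, c1, c2, c3, ← hR]
  simp only [Finset.sum_insert hi, Finset.sum_insert hj, Finset.sum_insert hi',
    Finset.sum_insert hi'', Finset.sum_insert hiR, Finset.sum_insert hjR, Finset.sum_add_distrib]
  rw [Sym2.eq_swap (a := j) (b := i)]
  ring

end Flow

/-! ### The path of partial sums along an ordering -/

section Chain

variable {m : ℕ} {ι : Type*} [DecidableEq ι]

/-- The sum of those arcs that carry a label in `I`, along the path of partial sums that starts at
`p` and has the steps `d i` for `i` in the list. -/
def chain (d : ι → ZMod m) (I : Finset ι) : ZMod m → List ι → ZMod m → ℤ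
  | _, [] => 0
  | p, i :: l => (if i ∈ I then arc p (d i) else 0) + chain d I (p + d i) l

theorem arc_zero (p : ZMod m) : arc p 0 = 0 := by simp [arc]

theorem arc_add (p a b : ZMod m) : arc p (a + b) = arc p a + arc (p + a) b := by
  simp [arc, add_assoc]

theorem chain_append (d : ι → ZMod m) (I : Finset ι) (p : ZMod m) (l l' : List ι) :
    chain d I p (l ++ l') = chain d I p l + chain d I (p + (l.map d).sum) l' := by
  induction l generalizing p with
  | nil => simp [chain]
  | cons i l ih => simp [chain, ih, add_assoc]

theorem chain_of_disjoint {d : ι → ZMod m} {I : Finset ι} {p : ZMod m} {l : List ι}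
    (h : ∀ i ∈ l, i ∉ I) : chain d I p l = 0 := by
  induction l generalizing p with
  | nil => rfl
  | cons i l ih =>
    simp [chain, h i (by simp), ih (p := p + d i) fun j hj => h j (List.mem_cons_of_mem _ hj)]

theorem chain_of_subset {d : ι → ZMod m} {I : Finset ι} {p : ZMod m} {l : List ι}
    (h : ∀ i ∈ l, i ∈ I) : chain d I p l = arc p (l.map d).sum := by
  induction l generalizing p with
  | nil => simp [chain, arc_zero]
  | cons i l ih =>
    simp [chain, h i (by simp), ih (p := p + d i) fun j hj => h j (List.mem_cons_of_mem _ hj),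
      arc_add]

theorem chain_eq_sum (d : ι → ZMod m) (I : Finset ι) (p : ZMod m) (l : List ι) :
    chain d I p l = ∑ i ∈ I, chain d {i} p l := by
  induction l generalizing p with
  | nil => simp [chain]
  | cons i l ih => simp [chain, ih (p + d i), Finset.sum_add_distrib]

theorem sum_chain [NeZero m] (d : ι → ZMod m) (I : Finset ι) (p : ZMod m) (l : List ι) :
    ∑ u, chain d I p l u = 0 := by
  induction l generalizing p with
  | nil => simp [chain]
  | cons i l ih =>
    simp only [chain, Pi.add_apply, Finset.sum_add_distrib, ih, add_zero]
    split_ifs <;> simp [arc]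

theorem moment_chain [NeZero m] (d : ι → ZMod m) (I : Finset ι) (p : ZMod m) (l : List ι) :
    ∑ u, (chain d I p l u : ZMod m) * u = (l.map fun i => if i ∈ I then d i else 0).sum := by
  induction l generalizing p with
  | nil => simp [chain]
  | cons i l ih =>
    simp only [chain, Pi.add_apply, Int.cast_add, add_mul, Finset.sum_add_distrib, ih,
      List.map_cons, List.sum_cons]
    congr 1
    split_ifs
    · simp only [arc, Pi.sub_apply, Int.cast_sub, sub_mul, Finset.sum_sub_distrib]
      rw [Finset.sum_eq_single (p + d i), Finset.sum_eq_single p]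
      · simp
      · intro v _ hv; simp [Pi.single_eq_of_ne hv]
      · simp
      · intro v _ hv; simp [Pi.single_eq_of_ne hv]
      · simp
    · simp

theorem chain_singleton {d : ι → ZMod m} {p : ZMod m} {i : ι} {l₁ l₂ : List ι}
    (h₁ : i ∉ l₁) (h₂ : i ∉ l₂) :
    chain d {i} p (l₁ ++ i :: l₂) = arc (p + (l₁.map d).sum) (d i) := by
  have n₁ : ∀ j ∈ l₁, j ∉ ({i} : Finset ι) := fun j hj e => h₁ (Finset.mem_singleton.mp e ▸ hj)
  have n₂ : ∀ j ∈ l₂, j ∉ ({i} : Finset ι) := fun j hj e => h₂ (Finset.mem_singleton.mp e ▸ hj)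
  simp [chain_append, chain, chain_of_disjoint n₁, chain_of_disjoint n₂]

end Chain

/-! ### Cyclic weightings -/

section Cyclic

variable {m n : ℕ}

theorem exists_eq_append_of_ne {α : Type*} {l : List α} {i j : α} (hi : i ∈ l) (hj : j ∈ l)
    (hij : i ≠ j) : (∃ l₁ l₂ l₃, l = l₁ ++ i :: (l₂ ++ j :: l₃)) ∨
      ∃ l₁ l₂ l₃, l = l₁ ++ j :: (l₂ ++ i :: l₃) := by
  obtain ⟨s, t, rfl⟩ := List.append_of_mem hi
  simp only [List.mem_append, List.mem_cons, hij.symm, false_or] at hj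
  rcases hj with hj | hj
  · obtain ⟨a, b, rfl⟩ := List.append_of_mem hj
    exact Or.inr ⟨a, b, t, by simp⟩
  · obtain ⟨a, b, rfl⟩ := List.append_of_mem hj
    exact Or.inl ⟨s, a, b, rfl⟩

/-- The weights of a weighting whose flow across each segment of an ordering is prescribed. -/
theorem weight_eq_neg_energyForm [NeZero m] {f : ZMod m → ℚ} (hf : IsSymm f) {d : Fin n → ZMod m}
    {l : List (Fin n)} (hl : l.Nodup) {w : Weighting n}
    (hw : ∀ l₁ l₂ l₃, l = l₁ ++ l₂ ++ l₃ → flow w l₂.toFinset = f (l₂.map d).sum)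
    {i j : Fin n} (hi : i ∈ l) (hj : j ∈ l) (hij : i ≠ j) :
    w s(i, j) = -energyForm f (chain d {i} 0 l) (chain d {j} 0 l) := by
  wlog h : ∃ l₁ l₂ l₃, l = l₁ ++ i :: (l₂ ++ j :: l₃) generalizing i j
  · rw [Sym2.eq_swap, energyForm_comm hf]
    exact this hj hi hij.symm ((exists_eq_append_of_ne hi hj hij).resolve_left h)
  obtain ⟨l₁, l₂, l₃, rfl⟩ := h
  -- With `A` the set of labels strictly between `i` and `j`, all four sets in `two_mul_weight` are
  -- segments, so their flows are prescribed.
  have k1 := hw (l₁ ++ [i]) l₂ (j :: l₃) (by simp)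
  have k2 := hw l₁ (i :: l₂) (j :: l₃) (by simp)
  have k3 := hw (l₁ ++ [i]) (l₂ ++ [j]) l₃ (by simp)
  have k4 := hw l₁ (i :: (l₂ ++ [j])) l₃ (by simp)
  have hi1 : i ∉ l₁ := by grind
  have hi2 : i ∉ l₂ := by grind
  have hi3 : i ∉ l₃ := by grind
  have hj1 : j ∉ l₁ := by grind
  have hj2 : j ∉ l₂ := by grind
  have hj3 : j ∉ l₃ := by grind
  have e3 : (l₂ ++ [j]).toFinset = insert j l₂.toFinset := by ext; simp
  rw [List.toFinset_cons] at k2 k4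
  rw [e3] at k3 k4
  have k := two_mul_weight w (A := l₂.toFinset) (i := i) (j := j) (by simpa) (by simpa) hij
  rw [k1, k2, k3, k4] at k
  have ei : chain d {i} 0 (l₁ ++ i :: (l₂ ++ j :: l₃)) = arc (l₁.map d).sum (d i) := by
    rw [chain_singleton hi1 (by simp [hi2, hi3, hij]), zero_add]
  have ej : chain d {j} 0 (l₁ ++ i :: (l₂ ++ j :: l₃)) =
      arc ((l₁.map d).sum + d i + (l₂.map d).sum) (d j) := by
    have : l₁ ++ i :: (l₂ ++ j :: l₃) = (l₁ ++ i :: l₂) ++ j :: l₃ := by simp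
    rw [this, chain_singleton (by simp [hj1, hj2, hij.symm]) hj3, zero_add]
    simp [add_assoc]
  rw [ei, ej, energyForm_arc]
  simp only [List.map_cons, List.map_append, List.map_nil, List.sum_cons, List.sum_append,
    List.sum_nil, add_zero] at k
  generalize (l₁.map d).sum = p at *
  generalize (l₂.map d).sum = a at *
  have e1 : p + d i - (p + d i + a + d j) = -(a + d j) := by abel
  have e2 : p + d i - (p + d i + a) = -a := by abel
  have e4 : p - (p + d i + a + d j) = -(d i + (a + d j)) := by abel
  have e5 : p - (p + d i + a) = -(d i + a) := by abel
  rw [e1, e2, e4, e5, hf, hf, hf, hf]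
  linarith

theorem flow_eq_energyForm [NeZero m] {f : ZMod m → ℚ} (hf : IsSymm f) {d : Fin n → ZMod m}
    (hd : ∑ i, d i = 0) {l : List (Fin n)} (hl : l.Nodup) (hmem : ∀ i, i ∈ l) {w : Weighting n}
    (hw : ∀ l₁ l₂ l₃, l = l₁ ++ l₂ ++ l₃ → flow w l₂.toFinset = f (l₂.map d).sum)
    (I : Finset (Fin n)) : flow w I = energyForm f (chain d I 0 l) (chain d I 0 l) := by
  -- The arcs of all the labels form a closed path because `d` has sum zero.
  have h0 : chain d I 0 l = -chain d Iᶜ 0 l := by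
    rw [eq_neg_iff_add_eq_zero, chain_eq_sum d I, chain_eq_sum d Iᶜ, Finset.sum_add_sum_compl,
      ← chain_eq_sum, chain_of_subset (by simp), ← List.sum_toFinset _ hl,
      Finset.eq_univ_iff_forall.mpr (fun i => List.mem_toFinset.mpr (hmem i)), hd, arc_zero]
  have h1 : energyForm f (chain d I 0 l) (chain d I 0 l) =
      -energyForm f (chain d I 0 l) (chain d Iᶜ 0 l) := by
    conv_lhs => rw [h0, energyForm_neg_neg]
    rw [h0]
    have := energyForm_neg_neg f (chain d Iᶜ 0 l) (-chain d Iᶜ 0 l)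
    have h2 := energyForm_add_right f (chain d Iᶜ 0 l) (chain d Iᶜ 0 l) (-chain d Iᶜ 0 l)
    rw [add_neg_cancel, energyForm_zero_right] at h2
    rw [neg_neg] at this
    linarith
  rw [h1, chain_eq_sum d I, chain_eq_sum d Iᶜ, energyForm_sum_left, ← Finset.sum_neg_distrib]
  refine Finset.sum_congr rfl fun i hi => ?_
  rw [energyForm_sum_right, ← Finset.sum_neg_distrib]
  refine Finset.sum_congr rfl fun j hj => ?_
  refine weight_eq_neg_energyForm hf hl hw (hmem i) (hmem j) fun e => ?_
  subst e
  exact Finset.mem_compl.mp hj hi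

/-- A cyclically effective function has a weighting adapted to every ordering of the labels. -/
theorem IsCyclicallyEffective.exists_weighting {f : ZMod m → ℚ} (hf : IsCyclicallyEffective f)
    (hf0 : f 0 = 0) (hn : 3 ≤ n) {d : Fin n → ZMod m} (hd : ∑ i, d i = 0) {l : List (Fin n)}
    (hl : l.Nodup) (hmem : ∀ i, i ∈ l) :
    ∃ w : Weighting n, IsAdmissible f d w ∧
      ∀ l₁ l₂ l₃, l = l₁ ++ l₂ ++ l₃ → flow w l₂.toFinset = f (l₂.map d).sum := by
  have : NeZero n := ⟨by omega⟩
  have hlen : l.length = n := by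
    have h1 := List.toFinset_card_of_nodup hl
    rw [Finset.eq_univ_iff_forall.mpr (fun i => List.mem_toFinset.mpr (hmem i))] at h1
    simpa using h1.symm
  have hlt : ∀ i, l.idxOf i < n := fun i => by
    have := List.idxOf_lt_length_iff.mpr (hmem i)
    omega
  have hcast : ∀ a b : ℕ, a < n → b < n → (a : ZMod n) = b → a = b := fun a b ha hb h => by
    have := congrArg ZMod.val h
    rwa [ZMod.val_natCast, ZMod.val_natCast, Nat.mod_eq_of_lt ha, Nat.mod_eq_of_lt hb] at this
  have hinj : Function.Injective fun i => ((l.idxOf i : ℕ) : ZMod n) := fun i j h =>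
    (List.idxOf_inj (hmem i)).mp (hcast _ _ (hlt i) (hlt j) h)
  have hbij := (Fintype.bijective_iff_injective_and_card _).mpr ⟨hinj, by simp [ZMod.card]⟩
  obtain ⟨w, hw, hc⟩ := hf.2 n hn d hd (Equiv.ofBijective _ hbij)
  refine ⟨w, hw, fun l₁ l₂ l₃ e => ?_⟩
  subst e
  have hnd : l₂.Nodup := (List.nodup_append.mp (List.nodup_append.mp hl).1).2.1
  rw [← List.sum_toFinset _ hnd]
  -- The empty and the full segment are not contiguous partitions; for them both sides vanish by `f
  -- 0 = 0`.
  by_cases h1 : l₂.toFinset = ∅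
  · rw [h1, flow_empty, Finset.sum_empty, hf0]
  by_cases h2 : l₂.toFinset = Finset.univ
  · rw [h2, flow_univ, hd, hf0]
  refine hc _ ⟨Finset.nonempty_iff_ne_empty.mpr h1, ?_, (l₁.length : ZMod n), l₂.length, ?_⟩
  · rwa [Finset.nonempty_iff_ne_empty, ne_eq, Finset.compl_eq_empty_iff]
  intro i
  simp only [Equiv.ofBijective_apply, List.mem_toFinset]
  constructor
  · intro hi
    obtain ⟨a, b, rfl⟩ := List.append_of_mem hi
    refine ⟨a.length, by simp, ?_⟩
    rw [← Nat.cast_add]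
    congr 1
    have e : l₁ ++ (a ++ i :: b) ++ l₃ = (l₁ ++ a) ++ i :: (b ++ l₃) := by simp
    have hni : i ∉ l₁ ++ a := by
      rw [e] at hl
      intro h
      exact (List.nodup_append.mp hl).2.2 i h i (by simp) rfl
    rw [e, List.idxOf_append_of_notMem hni]
    simp
  · rintro ⟨j, hj, hji⟩
    rw [← Nat.cast_add] at hji
    simp only [List.length_append] at hlen
    have := hcast _ _ (hlt i) (by omega) hji
    have hg : (l₁ ++ l₂ ++ l₃)[l₁.length + j]'(by simp; omega) = i := by
      have h3 := List.getElem_idxOf (xs := l₁ ++ l₂ ++ l₃) (x := i)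
        (List.idxOf_lt_length_iff.mpr (hmem i))
      simp only [this] at h3
      exact h3
    rw [← hg]
    simp [hj]

end Cyclic

/-! ### Rooted trees with binary and ternary nodes -/

/-- Rooted trees with leaves in `ι` all of whose nodes have two or three children. -/
inductive BTTree (ι : Type*) where
  | leaf (i : ι) : BTTree ι
  | bin (s t : BTTree ι) : BTTree ι
  | tri (s t u : BTTree ι) : BTTree ι

namespace BTTree

variable {ι : Type*}

/-- The leaves of a tree, from left to right. -/
def leaves : BTTree ι → List ι
  | leaf i => [i]
  | bin s t => s.leaves ++ t.leaves
  | tri s t u => s.leaves ++ (t.leaves ++ u.leaves)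

/-- The orderings of the leaves obtained by permuting the children of the nodes, where the three
children of a ternary node are only permuted cyclically. -/
def IsOrder : BTTree ι → List ι → Prop
  | leaf i, l => l = [i]
  | bin s t, l => ∃ a b, s.IsOrder a ∧ t.IsOrder b ∧ (l = a ++ b ∨ l = b ++ a)
  | tri s t u, l => ∃ a b c, s.IsOrder a ∧ t.IsOrder b ∧ u.IsOrder c ∧
      (l = a ++ (b ++ c) ∨ l = b ++ (c ++ a) ∨ l = c ++ (a ++ b))

/-- The average of a function over all the orderings of the leaves. -/
def avg : BTTree ι → (List ι → ℚ) → ℚ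
  | leaf i, F => F [i]
  | bin s t, F => s.avg fun a => t.avg fun b => (F (a ++ b) + F (b ++ a)) / 2
  | tri s t u, F => s.avg fun a => t.avg fun b => u.avg fun c =>
      (F (a ++ (b ++ c)) + F (b ++ (c ++ a)) + F (c ++ (a ++ b))) / 3

/-- `S` is the set of leaves below some node of the tree. -/
def HasBlock [DecidableEq ι] : BTTree ι → Finset ι → Prop
  | leaf i, S => S = {i}
  | bin s t, S => S = (bin s t).leaves.toFinset ∨ s.HasBlock S ∨ t.HasBlock S
  | tri s t u, S =>
      S = (tri s t u).leaves.toFinset ∨ s.HasBlock S ∨ t.HasBlock S ∨ u.HasBlock S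

/-- The sum of the labels below each node is non-zero, and the three children of a ternary node
have the same sum of labels, which is of order two. -/
def IsGood {G : Type*} [AddCommGroup G] (d : ι → G) : BTTree ι → Prop
  | leaf i => d i ≠ 0
  | bin s t => s.IsGood d ∧ t.IsGood d ∧ ((bin s t).leaves.map d).sum ≠ 0
  | tri s t u => s.IsGood d ∧ t.IsGood d ∧ u.IsGood d ∧
      (t.leaves.map d).sum = (s.leaves.map d).sum ∧ (u.leaves.map d).sum = (s.leaves.map d).sum ∧
      (s.leaves.map d).sum + (s.leaves.map d).sum = 0

theorem IsOrder.perm {t : BTTree ι} {l : List ι} (h : t.IsOrder l) : l.Perm t.leaves := by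
  induction t generalizing l with
  | leaf i => rw [show l = [i] from h]; rfl
  | bin s t hs ht =>
    obtain ⟨a, b, ha, hb, rfl | rfl⟩ := h
    · exact (hs ha).append (ht hb)
    · exact List.perm_append_comm.trans ((hs ha).append (ht hb))
  | tri s t u hs ht hu =>
    obtain ⟨a, b, c, ha, hb, hc, rfl | rfl | rfl⟩ := h
    · exact (hs ha).append ((ht hb).append (hu hc))
    · rw [← List.append_assoc]
      exact List.perm_append_comm.trans ((hs ha).append ((ht hb).append (hu hc)))
    · refine List.perm_append_comm.trans ?_
      rw [List.append_assoc]
      exact (hs ha).append ((ht hb).append (hu hc))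

theorem IsOrder.sum_map {G : Type*} [AddCommGroup G] {t : BTTree ι} {l : List ι}
    (h : t.IsOrder l) (d : ι → G) : (l.map d).sum = (t.leaves.map d).sum :=
  (h.perm.map d).sum_eq

theorem IsGood.sum_ne_zero {G : Type*} [AddCommGroup G] {d : ι → G} {t : BTTree ι}
    (h : t.IsGood d) : (t.leaves.map d).sum ≠ 0 := by
  induction t with
  | leaf i =>
    have h' : d i ≠ 0 := h
    simpa [leaves] using h'
  | bin s t => exact h.2.2
  | tri s t u hs ht hu =>
    obtain ⟨h1, h2, h3, e1, e2, e3⟩ := h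
    simp only [leaves, List.map_append, List.sum_append, e1, e2, e3, add_zero]
    exact hs h1

theorem avg_mono {t : BTTree ι} {F F' : List ι → ℚ} (h : ∀ l, t.IsOrder l → F l ≤ F' l) :
    t.avg F ≤ t.avg F' := by
  induction t generalizing F F' with
  | leaf i => exact h _ rfl
  | bin s t hs ht =>
    refine hs fun a ha => ht fun b hb => ?_
    have h1 := h (a ++ b) ⟨a, b, ha, hb, Or.inl rfl⟩
    have h2 := h (b ++ a) ⟨a, b, ha, hb, Or.inr rfl⟩
    linarith
  | tri s t u hs ht hu =>
    refine hs fun a ha => ht fun b hb => hu fun c hc => ?_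
    have h1 := h (a ++ (b ++ c)) ⟨a, b, c, ha, hb, hc, Or.inl rfl⟩
    have h2 := h (b ++ (c ++ a)) ⟨a, b, c, ha, hb, hc, Or.inr (Or.inl rfl)⟩
    have h3 := h (c ++ (a ++ b)) ⟨a, b, c, ha, hb, hc, Or.inr (Or.inr rfl)⟩
    linarith

theorem avg_congr {t : BTTree ι} {F F' : List ι → ℚ} (h : ∀ l, t.IsOrder l → F l = F' l) :
    t.avg F = t.avg F' :=
  le_antisymm (avg_mono fun l hl => (h l hl).le) (avg_mono fun l hl => (h l hl).ge)

theorem avg_const (t : BTTree ι) (c : ℚ) : (t.avg fun _ => c) = c := by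
  induction t with
  | leaf i => rfl
  | bin s t hs ht => simp [avg, hs, ht]
  | tri s t u hs ht hu =>
    have e : (c + c + c) / 3 = c := by ring
    simp only [avg, e, hs, ht, hu]

theorem avg_add (t : BTTree ι) (F F' : List ι → ℚ) :
    (t.avg fun l => F l + F' l) = t.avg F + t.avg F' := by
  induction t generalizing F F' with
  | leaf i => rfl
  | bin s t hs ht =>
    simp only [avg, ← hs, ← ht]
    congr 1; ext a; congr 1; ext b; ring
  | tri s t u hs ht hu =>
    simp only [avg, ← hs, ← ht, ← hu]
    congr 1; ext a; congr 1; ext b; congr 1; ext c; ring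

theorem avg_div (t : BTTree ι) (F : List ι → ℚ) (c : ℚ) :
    (t.avg fun l => F l / c) = t.avg F / c := by
  induction t generalizing F with
  | leaf i => rfl
  | bin s t hs ht =>
    simp only [avg, ← hs, ← ht]
    congr 1; ext a; congr 1; ext b; ring
  | tri s t u hs ht hu =>
    simp only [avg, ← hs, ← ht, ← hu]
    congr 1; ext a; congr 1; ext b; congr 1; ext c; ring

theorem avg_sum {κ : Type*} (t : BTTree ι) (A : Finset κ) (F : κ → List ι → ℚ) :
    (t.avg fun l => ∑ k ∈ A, F k l) = ∑ k ∈ A, t.avg (F k) := by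
  classical
  induction A using Finset.induction_on with
  | empty => simp [avg_const]
  | insert a A ha ih => simp only [Finset.sum_insert ha, avg_add, ih]

theorem le_avg {t : BTTree ι} {F : List ι → ℚ} {c : ℚ} (h : ∀ l, t.IsOrder l → c ≤ F l) :
    c ≤ t.avg F :=
  (avg_const t c).symm.le.trans (avg_mono h)

/-- Fubini for averages; it allows the orders of all children but one to be frozen. -/
theorem avg_comm (s t : BTTree ι) (F : List ι → List ι → ℚ) :
    (s.avg fun a => t.avg fun b => F a b) = t.avg fun b => s.avg fun a => F a b := by
  induction s generalizing F with
  | leaf i => rfl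
  | bin s s' hs hs' =>
    simp only [avg]
    rw [← hs]
    congr 1; ext a
    rw [← hs']
    congr 1; ext b
    rw [avg_div, avg_add]
  | tri s s' s'' hs hs' hs'' =>
    simp only [avg]
    rw [← hs]
    congr 1; ext a
    rw [← hs']
    congr 1; ext b
    rw [← hs'']
    congr 1; ext c
    rw [avg_div, avg_add, avg_add]

/-- Permuting the children of nodes never separates the leaves below a node. This is what makes the
averaged weighting exact across blocks. -/
theorem HasBlock.exists_segment [DecidableEq ι] {t : BTTree ι} {S : Finset ι} (h : t.HasBlock S)
    {l : List ι} (hl : t.IsOrder l) : ∃ l₁ l₂ l₃, l = l₁ ++ l₂ ++ l₃ ∧ l₂.toFinset = S := by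
  induction t generalizing l with
  | leaf i => exact ⟨[], l, [], by simp, by rw [show l = [i] from hl, show S = {i} from h]; simp⟩
  | bin s t hs ht =>
    rcases h with rfl | h | h
    · exact ⟨[], l, [], by simp, List.toFinset_eq_of_perm _ _ hl.perm⟩
    · obtain ⟨a, b, ha, hb, rfl | rfl⟩ := hl
      · obtain ⟨x, y, z, rfl, rfl⟩ := hs h ha
        exact ⟨x, y, z ++ b, by simp, rfl⟩
      · obtain ⟨x, y, z, rfl, rfl⟩ := hs h ha
        exact ⟨b ++ x, y, z, by simp, rfl⟩
    · obtain ⟨a, b, ha, hb, rfl | rfl⟩ := hl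
      · obtain ⟨x, y, z, rfl, rfl⟩ := ht h hb
        exact ⟨a ++ x, y, z, by simp, rfl⟩
      · obtain ⟨x, y, z, rfl, rfl⟩ := ht h hb
        exact ⟨x, y, z ++ a, by simp, rfl⟩
  | tri s t u hs ht hu =>
    rcases h with rfl | h | h | h
    · exact ⟨[], l, [], by simp, List.toFinset_eq_of_perm _ _ hl.perm⟩
    · obtain ⟨a, b, c, ha, hb, hc, hl⟩ := hl
      obtain ⟨x, y, z, rfl, rfl⟩ := hs h ha
      rcases hl with rfl | rfl | rfl
      · exact ⟨x, y, z ++ (b ++ c), by simp, rfl⟩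
      · exact ⟨b ++ (c ++ x), y, z, by simp, rfl⟩
      · exact ⟨c ++ x, y, z ++ b, by simp, rfl⟩
    · obtain ⟨a, b, c, ha, hb, hc, hl⟩ := hl
      obtain ⟨x, y, z, rfl, rfl⟩ := ht h hb
      rcases hl with rfl | rfl | rfl
      · exact ⟨a ++ x, y, z ++ c, by simp, rfl⟩
      · exact ⟨x, y, z ++ (c ++ a), by simp, rfl⟩
      · exact ⟨c ++ (a ++ x), y, z, by simp, rfl⟩
    · obtain ⟨a, b, c, ha, hb, hc, hl⟩ := hl
      obtain ⟨x, y, z, rfl, rfl⟩ := hu h hc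
      rcases hl with rfl | rfl | rfl
      · exact ⟨a ++ (b ++ x), y, z, by simp, rfl⟩
      · exact ⟨b ++ x, y, z ++ a, by simp, rfl⟩
      · exact ⟨x, y, z ++ (a ++ b), by simp, rfl⟩

end BTTree

/-! ### Averages of the energy -/

section Average

variable {m : ℕ} [NeZero m]

/-- If one of `x, y` vanishes, the other is `±z`, whose energy pays for both. -/
theorem minVal_le_avg_two {f : ZMod m → ℚ} {x y z : ZMod m → ℤ}
    (hx : x ≠ 0 → minVal f ≤ energyForm f x x) (hy : y ≠ 0 → minVal f ≤ energyForm f y y)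
    (hz : 2 * minVal f ≤ energyForm f z z) (hxy : y = x + z ∨ x = y + z) :
    minVal f ≤ (energyForm f x x + energyForm f y y) / 2 := by
  have hE : energyForm f 0 0 = 0 := energyForm_zero_left f 0
  by_cases h1 : x = 0
  · subst h1
    have : energyForm f y y = energyForm f z z := by
      rcases hxy with h | h
      · rw [h, zero_add]
      · rw [eq_neg_of_add_eq_zero_left h.symm, energyForm_neg_neg]
    rw [hE]; linarith
  · by_cases h2 : y = 0
    · subst h2
      have : energyForm f x x = energyForm f z z := by
        rcases hxy with h | h
        · rw [eq_neg_of_add_eq_zero_left h.symm, energyForm_neg_neg]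
        · rw [h, zero_add]
      rw [hE]; linarith
    · linarith [hx h1, hy h2]

/-- The vector `x` occurs for two of the three rotations. In the worst case `x = 0`, the single
vector `y = ±z` must pay for all three, hence the constant `4 ≥ 3`. -/
theorem minVal_le_avg_three {f : ZMod m → ℚ} {x y z : ZMod m → ℤ} (h0 : 0 ≤ minVal f)
    (hx : x ≠ 0 → minVal f ≤ energyForm f x x) (hy : y ≠ 0 → minVal f ≤ energyForm f y y)
    (hz : 4 * minVal f ≤ energyForm f z z) (hxy : y = x + z ∨ x = y + z) :
    minVal f ≤ (energyForm f x x + energyForm f x x + energyForm f y y) / 3 := by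
  have hE : energyForm f 0 0 = 0 := energyForm_zero_left f 0
  by_cases h1 : x = 0
  · subst h1
    have : energyForm f y y = energyForm f z z := by
      rcases hxy with h | h
      · rw [h, zero_add]
      · rw [eq_neg_of_add_eq_zero_left h.symm, energyForm_neg_neg]
    rw [hE]; linarith
  · by_cases h2 : y = 0
    · subst h2
      have : energyForm f x x = energyForm f z z := by
        rcases hxy with h | h
        · rw [eq_neg_of_add_eq_zero_left h.symm, energyForm_neg_neg]
        · rw [h, zero_add]
      rw [hE]; linarith
    · linarith [hx h1, hy h2]

end Average

section AverageEnergy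

variable {m : ℕ} {ι : Type*} [DecidableEq ι]

theorem BTTree.mono_of_not_split {t : BTTree ι} {I : Finset ι}
    (h : ¬((∃ i ∈ t.leaves, i ∈ I) ∧ ∃ i ∈ t.leaves, i ∉ I)) :
    (∀ i ∈ t.leaves, i ∈ I) ∨ ∀ i ∈ t.leaves, i ∉ I := by
  by_contra! h'
  obtain ⟨⟨i, hi, hiI⟩, j, hj, hjI⟩ := h'
  exact h ⟨⟨j, hj, hjI⟩, i, hi, hiI⟩

theorem chain_order_of_subset {d : ι → ZMod m} {I : Finset ι} {t : BTTree ι} {l : List ι}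
    (hl : t.IsOrder l) (h : ∀ i ∈ t.leaves, i ∈ I) (p : ZMod m) :
    chain d I p l = arc p (t.leaves.map d).sum := by
  rw [chain_of_subset fun i hi => h i (hl.perm.mem_iff.mp hi), hl.sum_map]

theorem chain_order_of_disjoint {d : ι → ZMod m} {I : Finset ι} {t : BTTree ι} {l : List ι}
    (hl : t.IsOrder l) (h : ∀ i ∈ t.leaves, i ∉ I) (p : ZMod m) :
    chain d I p l = 0 :=
  chain_of_disjoint fun i hi => h i (hl.perm.mem_iff.mp hi)

set_option linter.unusedSimpArgs false in
/-- If `I` contains some but not all leaves of a good tree, then the energy of the arcs labeled by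
`I`, averaged over the orderings of the tree, is at least `minVal f`. -/
theorem minVal_le_avg_energyForm [NeZero m] {f : ZMod m → ℚ} (hf : IsSymm f) (hf0 : f 0 = 0)
    (h0 : 0 ≤ minVal f)
    (hrect : ∀ a b : ZMod m, a ≠ 0 → b ≠ 0 →
      2 * minVal f ≤ 2 * f a + 2 * f b - f (a + b) - f (a - b))
    (htor : ∀ h : ZMod m, h ≠ 0 → h + h = 0 → minVal f ≤ f h)
    {d : ι → ZMod m} {I : Finset ι} {t : BTTree ι} (ht : t.IsGood d)
    (hI : (∃ i ∈ t.leaves, i ∈ I) ∧ ∃ i ∈ t.leaves, i ∉ I) (y : ZMod m → ℤ) (p : ZMod m)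
    (hy : ∀ l, t.IsOrder l → y + chain d I p l ≠ 0 →
      minVal f ≤ energyForm f (y + chain d I p l) (y + chain d I p l)) :
    minVal f ≤ t.avg fun l => energyForm f (y + chain d I p l) (y + chain d I p l) := by
  induction t generalizing y p with
  | leaf i =>
    obtain ⟨⟨j, hj, hjI⟩, k, hk, hkI⟩ := hI
    simp only [BTTree.leaves, List.mem_singleton] at hj hk
    subst hj; subst hk
    exact absurd hjI hkI
  | bin s t hs ht' =>
    obtain ⟨gs, gt, gst⟩ := ht
    simp only [BTTree.avg]
    have K1 : ∀ a b, s.IsOrder a → t.IsOrder b → _ := fun a b ha hb =>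
      hy (a ++ b) ⟨a, b, ha, hb, Or.inl rfl⟩
    have K2 : ∀ a b, s.IsOrder a → t.IsOrder b → _ := fun a b ha hb =>
      hy (b ++ a) ⟨a, b, ha, hb, Or.inr rfl⟩
    -- If `I` splits a child, freeze the order of the other child and put its arcs into the context
    -- `y`. They do not move when the split child is reordered, since the sum of that child is
    -- fixed; induction then applies for each relative position.
    by_cases Is : (∃ i ∈ s.leaves, i ∈ I) ∧ ∃ i ∈ s.leaves, i ∉ I
    · rw [BTTree.avg_comm]
      refine BTTree.le_avg fun b hb => ?_
      rw [BTTree.avg_div, BTTree.avg_add]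
      have k1 := hs gs Is (y + chain d I (p + (s.leaves.map d).sum) b) p
      have k2 := hs gs Is (y + chain d I p b) (p + (b.map d).sum)
      have e1 : ∀ a, s.IsOrder a → y + chain d I p (a ++ b) =
          y + chain d I (p + (s.leaves.map d).sum) b + chain d I p a := fun a ha => by
        rw [chain_append, ha.sum_map]; abel
      have e2 : ∀ a, s.IsOrder a → y + chain d I p (b ++ a) =
          y + chain d I p b + chain d I (p + (b.map d).sum) a := fun a ha => by
        rw [chain_append]; abel
      replace k1 := k1 fun a ha => e1 a ha ▸ K1 a b ha hb
      replace k2 := k2 fun a ha => e2 a ha ▸ K2 a b ha hb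
      rw [BTTree.avg_congr fun a ha => by rw [← e1 a ha]] at k1
      rw [BTTree.avg_congr fun a ha => by rw [← e2 a ha]] at k2
      linarith
    by_cases It : (∃ i ∈ t.leaves, i ∈ I) ∧ ∃ i ∈ t.leaves, i ∉ I
    · refine BTTree.le_avg fun a ha => ?_
      rw [BTTree.avg_div, BTTree.avg_add]
      have k1 := ht' gt It (y + chain d I p a) (p + (a.map d).sum)
      have k2 := ht' gt It (y + chain d I (p + (t.leaves.map d).sum) a) p
      have e1 : ∀ b, t.IsOrder b → y + chain d I p (a ++ b) =
          y + chain d I p a + chain d I (p + (a.map d).sum) b := fun b hb => by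
        rw [chain_append]; abel
      have e2 : ∀ b, t.IsOrder b → y + chain d I p (b ++ a) =
          y + chain d I (p + (t.leaves.map d).sum) a + chain d I p b := fun b hb => by
        rw [chain_append, hb.sum_map]; abel
      replace k1 := k1 fun b hb => e1 b hb ▸ K1 a b ha hb
      replace k2 := k2 fun b hb => e2 b hb ▸ K2 a b ha hb
      rw [BTTree.avg_congr fun b hb => by rw [← e1 b hb]] at k1
      rw [BTTree.avg_congr fun b hb => by rw [← e2 b hb]] at k2
      linarith
    -- Now each child lies inside `I` or is disjoint from it, so its contribution is a single arc or
    -- zero, and only the flip of the two children matters.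
    refine BTTree.le_avg fun a ha => BTTree.le_avg fun b hb => ?_
    have k1 := K1 a b ha hb
    have k2 := K2 a b ha hb
    have hc := hrect _ _ gs.sum_ne_zero gt.sum_ne_zero
    have hc' := hrect _ _ gt.sum_ne_zero gs.sum_ne_zero
    have r1 := energyForm_rectangle hf hf0 p (s.leaves.map d).sum (t.leaves.map d).sum
    have r2 := energyForm_rectangle hf hf0 p (t.leaves.map d).sum (s.leaves.map d).sum
    rw [← r1] at hc
    rw [← r2] at hc'
    simp only [chain_append, ha.sum_map, hb.sum_map] at k1 k2 ⊢
    obtain ⟨⟨i, hi, hiI⟩, j, hj, hjI⟩ := hI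
    simp only [BTTree.leaves, List.mem_append] at hi hj
    rcases BTTree.mono_of_not_split Is with As | As <;>
    rcases BTTree.mono_of_not_split It with At | At
    · exact absurd (hj.elim (As j) (At j)) hjI
    · simp only [chain_order_of_subset ha As, chain_order_of_disjoint hb At, add_zero,
        zero_add] at k1 k2 ⊢
      exact minVal_le_avg_two k1 k2 hc (Or.inl (by abel))
    · simp only [chain_order_of_subset hb At, chain_order_of_disjoint ha As, add_zero,
        zero_add] at k1 k2 ⊢
      exact minVal_le_avg_two k1 k2 hc' (Or.inr (by abel))
    · exact absurd hiI (hi.elim (As i) (At i))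
  | tri s t u hs ht' hu =>
    obtain ⟨gs, gt, gu, et, eu, e2⟩ := ht
    simp only [BTTree.avg]
    have K1 : ∀ a b c, s.IsOrder a → t.IsOrder b → u.IsOrder c → _ := fun a b c ha hb hc =>
      hy (a ++ (b ++ c)) ⟨a, b, c, ha, hb, hc, Or.inl rfl⟩
    have K2 : ∀ a b c, s.IsOrder a → t.IsOrder b → u.IsOrder c → _ := fun a b c ha hb hc =>
      hy (b ++ (c ++ a)) ⟨a, b, c, ha, hb, hc, Or.inr (Or.inl rfl)⟩
    have K3 : ∀ a b c, s.IsOrder a → t.IsOrder b → u.IsOrder c → _ := fun a b c ha hb hc =>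
      hy (c ++ (a ++ b)) ⟨a, b, c, ha, hb, hc, Or.inr (Or.inr rfl)⟩
    -- the arcs of a child lie in a context that depends on the other two children
    have ctx : ∀ (v : BTTree ι) (x z : List ι), v.IsGood d →
        ((∃ i ∈ v.leaves, i ∈ I) ∧ ∃ i ∈ v.leaves, i ∉ I) →
        (∀ (y : ZMod m → ℤ) (p : ZMod m), (∀ l, v.IsOrder l → y + chain d I p l ≠ 0 →
          minVal f ≤ energyForm f (y + chain d I p l) (y + chain d I p l)) →
          minVal f ≤ v.avg fun l => energyForm f (y + chain d I p l) (y + chain d I p l)) →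
        (∀ l, v.IsOrder l → y + chain d I p (x ++ (l ++ z)) ≠ 0 → minVal f ≤
          energyForm f (y + chain d I p (x ++ (l ++ z))) (y + chain d I p (x ++ (l ++ z)))) →
        minVal f ≤ v.avg fun l =>
          energyForm f (y + chain d I p (x ++ (l ++ z))) (y + chain d I p (x ++ (l ++ z))) := by
      intro v x z gv Iv hv hK
      have e : ∀ l, v.IsOrder l → y + chain d I p (x ++ (l ++ z)) =
          y + chain d I p x + chain d I (p + (x.map d).sum + (v.leaves.map d).sum) z +
            chain d I (p + (x.map d).sum) l := fun l hl => by
        rw [chain_append, chain_append, hl.sum_map]; abel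
      rw [BTTree.avg_congr fun l hl => by rw [e l hl]]
      exact hv _ _ fun l hl => e l hl ▸ hK l hl
    by_cases Is : (∃ i ∈ s.leaves, i ∈ I) ∧ ∃ i ∈ s.leaves, i ∉ I
    · rw [BTTree.avg_comm]
      refine BTTree.le_avg fun b hb => ?_
      rw [BTTree.avg_comm]
      refine BTTree.le_avg fun c hc => ?_
      rw [BTTree.avg_div, BTTree.avg_add, BTTree.avg_add]
      have k1 := ctx s [] (b ++ c) gs Is (hs gs Is) fun a ha => K1 a b c ha hb hc
      have k2 := ctx s (b ++ c) [] gs Is (hs gs Is) fun a ha => by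
        simpa using K2 a b c ha hb hc
      have k3 := ctx s c b gs Is (hs gs Is) fun a ha => K3 a b c ha hb hc
      simp only [List.append_assoc, List.append_nil, List.nil_append] at k1 k2 k3
      linarith
    by_cases It : (∃ i ∈ t.leaves, i ∈ I) ∧ ∃ i ∈ t.leaves, i ∉ I
    · refine BTTree.le_avg fun a ha => ?_
      rw [BTTree.avg_comm]
      refine BTTree.le_avg fun c hc => ?_
      rw [BTTree.avg_div, BTTree.avg_add, BTTree.avg_add]
      have k1 := ctx t a c gt It (ht' gt It) fun b hb => K1 a b c ha hb hc
      have k2 := ctx t [] (c ++ a) gt It (ht' gt It) fun b hb => K2 a b c ha hb hc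
      have k3 := ctx t (c ++ a) [] gt It (ht' gt It) fun b hb => by
        simpa using K3 a b c ha hb hc
      simp only [List.append_assoc, List.append_nil, List.nil_append] at k1 k2 k3
      linarith
    by_cases Iu : (∃ i ∈ u.leaves, i ∈ I) ∧ ∃ i ∈ u.leaves, i ∉ I
    · refine BTTree.le_avg fun a ha => BTTree.le_avg fun b hb => ?_
      rw [BTTree.avg_div, BTTree.avg_add, BTTree.avg_add]
      have k1 := ctx u (a ++ b) [] gu Iu (hu gu Iu) fun c hc => by
        simpa using K1 a b c ha hb hc
      have k2 := ctx u b a gu Iu (hu gu Iu) fun c hc => K2 a b c ha hb hc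
      have k3 := ctx u [] (a ++ b) gu Iu (hu gu Iu) fun c hc => K3 a b c ha hb hc
      simp only [List.append_assoc, List.append_nil, List.nil_append] at k1 k2 k3
      linarith
    refine BTTree.le_avg fun a ha => BTTree.le_avg fun b hb => BTTree.le_avg fun c hc => ?_
    have k1 := K1 a b c ha hb hc
    have k2 := K2 a b c ha hb hc
    have k3 := K3 a b c ha hb hc
    have hne := gs.sum_ne_zero
    simp only [chain_append, ha.sum_map, hb.sum_map, hc.sum_map, et, eu] at k1 k2 k3 ⊢
    obtain ⟨⟨i, hi, hiI⟩, j, hj, hjI⟩ := hI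
    simp only [BTTree.leaves, List.mem_append] at hi hj
    generalize hh : (s.leaves.map d).sum = h at *
    -- The path goes back and forth between `p` and `p + h`: the children in first and third
    -- position contribute `arc p h`, the one in second position its negative. Hence two of the
    -- three rotations give the same vector, and the remaining one differs by `2 * arc p h`.
    have hp : p + h + h = p := by rw [add_assoc, e2, add_zero]
    have ha' : arc (p + h) h = -arc p h := by
      simp [arc, hp]
    have hz : 4 * minVal f ≤ energyForm f (arc p h + arc p h) (arc p h + arc p h) := by
      have r := energyForm_rectangle hf hf0 p h h
      have hn : (arc (p + h) h - arc p h) = -(arc p h + arc p h) := by rw [ha']; abel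
      rw [hn, energyForm_neg_neg, e2, sub_self, hf0] at r
      have := htor h hne e2
      linarith
    have avg3 : ∀ {x y : ZMod m → ℤ}, (x ≠ 0 → minVal f ≤ energyForm f x x) →
        (y ≠ 0 → minVal f ≤ energyForm f y y) →
        (y = x + (arc p h + arc p h) ∨ x = y + (arc p h + arc p h)) →
        3 * minVal f ≤ energyForm f x x + energyForm f x x + energyForm f y y :=
      fun hx hy hxy => by linarith [minVal_le_avg_three h0 hx hy hz hxy]
    rw [le_div_iff₀ (by norm_num : (0 : ℚ) < 3)]
    rcases BTTree.mono_of_not_split Is with As | As <;>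
    rcases BTTree.mono_of_not_split It with At | At <;>
    rcases BTTree.mono_of_not_split Iu with Au | Au
    · exact absurd (hj.elim (As j) fun h => h.elim (At j) (Au j)) hjI
    · simp only [chain_order_of_subset ha As, chain_order_of_subset hb At,
        chain_order_of_disjoint hc Au, hh, et, eu, hp, ha', add_neg_cancel, neg_add_cancel,
        add_zero, zero_add] at k1 k2 k3 ⊢
      linarith [avg3 k1 k2 (Or.inl (by abel))]
    · simp only [chain_order_of_subset ha As, chain_order_of_disjoint hb At,
        chain_order_of_subset hc Au, hh, et, eu, hp, ha', add_neg_cancel, neg_add_cancel,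
        add_zero, zero_add] at k1 k2 k3 ⊢
      linarith [avg3 k2 k1 (Or.inl (by abel))]
    · simp only [chain_order_of_subset ha As, chain_order_of_disjoint hb At,
        chain_order_of_disjoint hc Au, hh, et, eu, hp, ha', add_neg_cancel, neg_add_cancel,
        add_zero, zero_add] at k1 k2 k3 ⊢
      linarith [avg3 k1 k3 (Or.inr (by abel))]
    · simp only [chain_order_of_disjoint ha As, chain_order_of_subset hb At,
        chain_order_of_subset hc Au, hh, et, eu, hp, ha', add_neg_cancel, neg_add_cancel,
        add_zero, zero_add] at k1 k2 k3 ⊢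
      linarith [avg3 k1 k3 (Or.inl (by abel))]
    · simp only [chain_order_of_disjoint ha As, chain_order_of_subset hb At,
        chain_order_of_disjoint hc Au, hh, et, eu, hp, ha', add_neg_cancel, neg_add_cancel,
        add_zero, zero_add] at k1 k2 k3 ⊢
      linarith [avg3 k2 k1 (Or.inr (by abel))]
    · simp only [chain_order_of_disjoint ha As, chain_order_of_disjoint hb At,
        chain_order_of_subset hc Au, hh, et, eu, hp, ha', add_neg_cancel, neg_add_cancel,
        add_zero, zero_add] at k1 k2 k3 ⊢
      linarith [avg3 k1 k2 (Or.inr (by abel))]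
    · exact absurd hiI (hi.elim (As i) fun h => h.elim (At i) (Au i))

end AverageEnergy

/-! ### Laminar families -/

section Laminar

variable {ι : Type*}

/-- Two finite sets are nested or disjoint. -/
def NestedOrDisjoint (A B : Finset ι) : Prop := A ⊆ B ∨ B ⊆ A ∨ Disjoint A B

theorem NestedOrDisjoint.symm {A B : Finset ι} (h : NestedOrDisjoint A B) :
    NestedOrDisjoint B A := by
  rcases h with h | h | h
  exacts [Or.inr (Or.inl h), Or.inl h, Or.inr (Or.inr h.symm)]

/-- A laminar family of subsets of `S₀` with non-zero sums of labels. -/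
def IsLaminar {G : Type*} [AddCommGroup G] (d : ι → G) (S₀ : Finset ι)
    (𝓕 : Set (Finset ι)) : Prop :=
  (∀ F ∈ 𝓕, F ⊆ S₀ ∧ ∑ i ∈ F, d i ≠ 0) ∧ ∀ A ∈ 𝓕, ∀ B ∈ 𝓕, NestedOrDisjoint A B

theorem mem_of_maximal_isLaminar {G : Type*} [AddCommGroup G] {d : ι → G} {S₀ : Finset ι}
    {𝓜 : Set (Finset ι)} (h𝓜 : Maximal (IsLaminar d S₀) 𝓜) {A : Finset ι} (hA : A ⊆ S₀)
    (hA0 : ∑ i ∈ A, d i ≠ 0) (hc : ∀ F ∈ 𝓜, NestedOrDisjoint F A) : A ∈ 𝓜 := by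
  have h : IsLaminar d S₀ (insert A 𝓜) := by
    refine ⟨?_, ?_⟩
    · rintro F (rfl | hF)
      exacts [⟨hA, hA0⟩, h𝓜.1.1 F hF]
    · rintro F (rfl | hF) F' (rfl | hF')
      exacts [Or.inl subset_rfl, (hc F' hF').symm, hc F hF, h𝓜.1.2 F hF F' hF']
  exact h𝓜.2 h (Set.subset_insert A 𝓜) (Set.mem_insert A 𝓜)

/-- The members of a maximal laminar family are the sets of leaves below the nodes of a good tree
with binary and ternary nodes. -/
theorem exists_tree_of_maximal [DecidableEq ι] {G : Type*} [AddCommGroup G] {d : ι → G} {S₀ : Finset ι}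
    {𝓜 : Set (Finset ι)} (h𝓜 : Maximal (IsLaminar d S₀) 𝓜) (hsing : ∀ i ∈ S₀, {i} ∈ 𝓜)
    (k : ℕ) (S : Finset ι) (hk : S.card = k) (hS : S ∈ 𝓜) :
    ∃ t : BTTree ι, t.leaves.Nodup ∧ t.leaves.toFinset = S ∧ t.IsGood d ∧
      ∀ F ∈ 𝓜, F ⊆ S → t.HasBlock F := by
  induction k using Nat.strong_induction_on generalizing S with
  | _ k ih =>
  have hne : ∀ F ∈ 𝓜, F.Nonempty := fun F hF => by
    rw [Finset.nonempty_iff_ne_empty]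
    rintro rfl
    exact (h𝓜.1.1 _ hF).2 (by simp)
  have hS₀ := (h𝓜.1.1 S hS).1
  by_cases h1 : ∃ i, S = {i}
  · obtain ⟨i, rfl⟩ := h1
    refine ⟨.leaf i, by simp [BTTree.leaves], by simp [BTTree.leaves], ?_, fun F hF hFi => ?_⟩
    · have := (h𝓜.1.1 _ hS).2
      rwa [Finset.sum_singleton] at this
    · exact (hne F hF).subset_singleton_iff.mp hFi
  -- The child through `x` is the largest member of the family that contains `x` and is properly
  -- contained in `S`.
  have hchild : ∀ x ∈ S, ∃ C ∈ 𝓜, x ∈ C ∧ C ⊂ S ∧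
      ∀ F ∈ 𝓜, F ⊂ S → F ⊆ C ∨ Disjoint F C := by
    classical
    intro x hx
    have hfin : (S.powerset.filter fun F => F ∈ 𝓜 ∧ x ∈ F ∧ F ⊂ S).Nonempty := by
      refine ⟨{x}, ?_⟩
      simp only [Finset.mem_filter, Finset.mem_powerset, Finset.singleton_subset_iff,
        Finset.mem_singleton, true_and]
      refine ⟨hx, hsing x (hS₀ hx), Finset.ssubset_iff_subset_ne.mpr
        ⟨Finset.singleton_subset_iff.mpr hx, fun e => h1 ⟨x, e.symm⟩⟩⟩
    obtain ⟨C, hC, hmax⟩ := Finset.exists_max_image _ Finset.card hfin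
    simp only [Finset.mem_filter, Finset.mem_powerset] at hC hmax
    refine ⟨C, hC.2.1, hC.2.2.1, hC.2.2.2, fun F hF hFS => ?_⟩
    rcases h𝓜.1.2 F hF C hC.2.1 with h | h | h
    · exact Or.inl h
    · exact Or.inl (Finset.eq_of_subset_of_card_le h
        (hmax F ⟨hFS.subset, hF, h hC.2.2.1, hFS⟩)).ge
    · exact Or.inr h
  -- a union of children with non-zero sum belongs to the family
  have hunion : ∀ U ⊆ S, (∀ F ∈ 𝓜, F ⊂ S → F ⊆ U ∨ Disjoint F U) → ∑ i ∈ U, d i ≠ 0 →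
      U ∈ 𝓜 := by
    intro U hU hF h0
    refine mem_of_maximal_isLaminar h𝓜 (hU.trans hS₀) h0 fun F hF' => ?_
    have hsup : S ⊆ F → NestedOrDisjoint F U := fun h => Or.inr (Or.inl (hU.trans h))
    rcases h𝓜.1.2 F hF' S hS with h | h | h
    · rcases h.eq_or_ssubset with h | h
      · exact hsup h.ge
      · rcases hF F hF' h with h | h
        exacts [Or.inl h, Or.inr (Or.inr h)]
    · exact hsup h
    · exact Or.inr (Or.inr (h.mono_right hU))
  have hjoin : ∀ U V : Finset ι, (∀ F ∈ 𝓜, F ⊂ S → F ⊆ U ∨ Disjoint F U) →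
      (∀ F ∈ 𝓜, F ⊂ S → F ⊆ V ∨ Disjoint F V) →
      ∀ F ∈ 𝓜, F ⊂ S → F ⊆ U ∪ V ∨ Disjoint F (U ∪ V) := by
    intro U V hU hV F hF hFS
    rcases hU F hF hFS with h | h
    · exact Or.inl (h.trans Finset.subset_union_left)
    rcases hV F hF hFS with h' | h'
    · exact Or.inl (h'.trans Finset.subset_union_right)
    · exact Or.inr (Finset.disjoint_union_right.mpr ⟨h, h'⟩)
  have hdisj : ∀ A B : Finset ι, (∀ F ∈ 𝓜, F ⊂ S → F ⊆ A ∨ Disjoint F A) → B ∈ 𝓜 → B ⊂ S →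
      ∀ y ∈ B, y ∉ A → Disjoint A B := fun A B hA hB hBS y hy hyA =>
    ((hA B hB hBS).resolve_left fun h => hyA (h hy)).symm
  -- A proper union of at least two children cannot belong to the family, as this would contradict
  -- the maximality of a child. By maximality of the family its sum must be zero.
  have hzero : ∀ U A : Finset ι, U ⊆ S → U ≠ S →
      (∀ F ∈ 𝓜, F ⊂ S → F ⊆ U ∨ Disjoint F U) → A.Nonempty → A ⊂ U →
      (∀ F ∈ 𝓜, F ⊂ S → F ⊆ A ∨ Disjoint F A) → ∑ i ∈ U, d i = 0 := by
    intro U A hUS hne' hU ⟨x, hx⟩ hAU hA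
    by_contra h0
    rcases hA U (hunion U hUS hU h0) (Finset.ssubset_iff_subset_ne.mpr ⟨hUS, hne'⟩) with h | h
    · exact hAU.not_subset h
    · exact Finset.disjoint_left.mp h (hAU.subset hx) hx
  obtain ⟨x, hx⟩ := hne S hS
  obtain ⟨A, hA, hxA, hAS, hAc⟩ := hchild x hx
  obtain ⟨y, hy, hyA⟩ := Finset.exists_of_ssubset hAS
  obtain ⟨B, hB, hyB, hBS, hBc⟩ := hchild y hy
  have hAB := hdisj A B hAc hB hBS y hyB hyA
  have hsumAB := Finset.sum_union hAB (f := d)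
  have hlist : ∀ (t : BTTree ι) (C : Finset ι), t.leaves.Nodup → t.leaves.toFinset = C →
      (t.leaves.map d).sum = ∑ i ∈ C, d i := fun t C hn he => by
    rw [← he, List.sum_toFinset _ hn]
  have hld : ∀ (t t' : BTTree ι) (C C' : Finset ι), t.leaves.toFinset = C →
      t'.leaves.toFinset = C' → Disjoint C C' → t.leaves.Disjoint t'.leaves := by
    rintro t t' C C' rfl rfl h
    exact List.disjoint_toFinset_iff_disjoint.mp h
  obtain ⟨ta, na, la, ga, ba⟩ := ih _ (hk ▸ Finset.card_lt_card hAS) A rfl hA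
  obtain ⟨tb, nb, lb, gb, bb⟩ := ih _ (hk ▸ Finset.card_lt_card hBS) B rfl hB
  have dab := hld ta tb A B la lb hAB
  by_cases hU : A ∪ B = S
  · have hleaves : (BTTree.bin ta tb).leaves.toFinset = S := by
      simp [BTTree.leaves, List.toFinset_append, la, lb, hU]
    have hnod : (BTTree.bin ta tb).leaves.Nodup := na.append nb dab
    refine ⟨.bin ta tb, hnod, hleaves, ⟨ga, gb, ?_⟩, fun F hF hFS => ?_⟩
    · rw [hlist _ _ hnod hleaves]
      exact (h𝓜.1.1 S hS).2
    · rcases hFS.eq_or_ssubset with h | h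
      · exact Or.inl (h.trans hleaves.symm)
      rcases hAc F hF h with h' | h'
      · exact Or.inr (Or.inl (ba F hF h'))
      rcases hBc F hF h with h'' | h''
      · exact Or.inr (Or.inr (bb F hF h''))
      have := Finset.disjoint_union_right.mpr ⟨h', h''⟩
      rw [hU] at this
      exact absurd (this.eq_bot_of_le hFS) (hne F hF).ne_empty
  obtain ⟨z, hz, hzU⟩ := Finset.exists_of_ssubset
    (Finset.ssubset_iff_subset_ne.mpr ⟨Finset.union_subset hAS.subset hBS.subset, hU⟩)
  obtain ⟨C, hC, hzC, hCS, hCc⟩ := hchild z hz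
  rw [Finset.mem_union, not_or] at hzU
  have hAC := hdisj A C hAc hC hCS z hzC hzU.1
  have hBC := hdisj B C hBc hC hCS z hzC hzU.2
  have hproper : ∀ U V : Finset ι, Disjoint U V → V.Nonempty → U ⊂ U ∪ V := by
    intro U V hd ⟨v, hv⟩
    exact Finset.ssubset_iff_subset_ne.mpr ⟨Finset.subset_union_left, fun e =>
      Finset.disjoint_left.mp hd (e ▸ Finset.mem_union_right U hv) hv⟩
  -- With a third child present, all pairwise sums vanish. Hence the three sums coincide and are
  -- killed by two.
  have zAB : ∑ i ∈ A, d i + ∑ i ∈ B, d i = 0 := by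
    rw [← hsumAB]
    exact hzero _ A (Finset.union_subset hAS.subset hBS.subset) hU (hjoin A B hAc hBc) ⟨x, hxA⟩
      (hproper A B hAB ⟨y, hyB⟩) hAc
  have zAC : ∑ i ∈ A, d i + ∑ i ∈ C, d i = 0 := by
    rw [← Finset.sum_union hAC]
    refine hzero _ A (Finset.union_subset hAS.subset hCS.subset) (fun e => ?_)
      (hjoin A C hAc hCc) ⟨x, hxA⟩ (hproper A C hAC ⟨z, hzC⟩) hAc
    rw [← e, Finset.mem_union] at hy
    exact hy.elim hyA (Finset.disjoint_left.mp hBC hyB)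
  have zBC : ∑ i ∈ B, d i + ∑ i ∈ C, d i = 0 := by
    rw [← Finset.sum_union hBC]
    refine hzero _ B (Finset.union_subset hBS.subset hCS.subset) (fun e => ?_)
      (hjoin B C hBc hCc) ⟨y, hyB⟩ (hproper B C hBC ⟨z, hzC⟩) hBc
    rw [← e, Finset.mem_union] at hx
    exact hx.elim (Finset.disjoint_left.mp hAB hxA) (Finset.disjoint_left.mp hAC hxA)
  have eBC : ∑ i ∈ B, d i = ∑ i ∈ C, d i := add_left_cancel (zAB.trans zAC.symm)
  have eAB : ∑ i ∈ A, d i = ∑ i ∈ B, d i := by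
    rw [eBC]; rw [← zBC] at zAC; exact (add_right_cancel zAC).trans eBC
  have e2 : ∑ i ∈ A, d i + ∑ i ∈ A, d i = 0 := by
    nth_rewrite 2 [eAB]; exact zAB
  have hABC : Disjoint A (B ∪ C) := Finset.disjoint_union_right.mpr ⟨hAB, hAC⟩
  -- There is no fourth child: otherwise the union of three would have sum zero, but this sum equals
  -- that of `A`.
  have hU3 : A ∪ (B ∪ C) = S := by
    by_contra hne3
    have h0 := hzero (A ∪ (B ∪ C)) A (Finset.union_subset hAS.subset
      (Finset.union_subset hBS.subset hCS.subset)) hne3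
      (hjoin _ _ hAc (hjoin _ _ hBc hCc)) ⟨x, hxA⟩
      (hproper A _ hABC ⟨y, Finset.mem_union_left _ hyB⟩) hAc
    rw [Finset.sum_union hABC, Finset.sum_union hBC, zBC, add_zero] at h0
    exact (h𝓜.1.1 A hA).2 h0
  obtain ⟨tc, nc, lc, gc, bc⟩ := ih _ (hk ▸ Finset.card_lt_card hCS) C rfl hC
  have hleaves : (BTTree.tri ta tb tc).leaves.toFinset = S := by
    simp [BTTree.leaves, List.toFinset_append, la, lb, lc, hU3]
  refine ⟨.tri ta tb tc, ?_, hleaves, ⟨ga, gb, gc, ?_, ?_, ?_⟩, fun F hF hFS => ?_⟩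
  · refine na.append (nb.append nc (hld tb tc B C lb lc hBC)) ?_
    exact List.disjoint_append_right.mpr ⟨dab, hld ta tc A C la lc hAC⟩
  · rw [hlist _ _ nb lb, hlist _ _ na la, eAB]
  · rw [hlist _ _ nc lc, hlist _ _ na la, eAB, eBC]
  · rw [hlist _ _ na la, e2]
  · rcases hFS.eq_or_ssubset with h | h
    · exact Or.inl (h.trans hleaves.symm)
    rcases hAc F hF h with h1 | h1
    · exact Or.inr (Or.inl (ba F hF h1))
    rcases hBc F hF h with h2 | h2
    · exact Or.inr (Or.inr (Or.inl (bb F hF h2)))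
    rcases hCc F hF h with h3 | h3
    · exact Or.inr (Or.inr (Or.inr (bc F hF h3)))
    have := Finset.disjoint_union_right.mpr ⟨h1, Finset.disjoint_union_right.mpr ⟨h2, h3⟩⟩
    rw [hU3] at this
    exact absurd (this.eq_bot_of_le hFS) (hne F hF).ne_empty

/-- There are finitely many families of subsets, so the given one extends to a maximal one. -/
theorem exists_tree_of_isLaminar [Finite ι] [DecidableEq ι] {G : Type*} [AddCommGroup G] {d : ι → G}
    {S₀ : Finset ι} {𝓕 : Set (Finset ι)} (h𝓕 : IsLaminar d S₀ 𝓕) (hsing : ∀ i ∈ S₀, {i} ∈ 𝓕)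
    (hS₀ : S₀ ∈ 𝓕) :
    ∃ t : BTTree ι, t.leaves.Nodup ∧ t.leaves.toFinset = S₀ ∧ t.IsGood d ∧
      ∀ F ∈ 𝓕, t.HasBlock F := by
  have := Fintype.ofFinite ι
  obtain ⟨𝓜, hle, h𝓜⟩ := (Set.toFinite {𝓜 | IsLaminar d S₀ 𝓜}).exists_le_maximal h𝓕
  obtain ⟨t, h1, h2, h3, h4⟩ := exists_tree_of_maximal h𝓜 (fun i hi => hle (hsing i hi)) _ S₀ rfl
    (hle hS₀)
  exact ⟨t, h1, h2, h3, fun F hF => h4 F (hle hF) (h𝓕.1 F hF).1⟩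

end Laminar

/-! ### Partitions of the leaves of a tree -/

section Graph

variable {V : Type*} {T : SimpleGraph V} {n : ℕ} {leaf : Fin n → V}

theorem reachable_deleteEdges_or (hT : T.Connected) (u v x : V) :
    (T.deleteEdges {s(u, v)}).Reachable u x ∨ (T.deleteEdges {s(u, v)}).Reachable v x := by
  obtain ⟨p⟩ := hT.preconnected x u
  induction p with
  | nil => exact Or.inl .rfl
  | @cons a b c h p ih =>
    by_cases he : s(a, b) = s(c, v)
    · rcases Sym2.eq_iff.mp he with ⟨rfl, -⟩ | ⟨rfl, -⟩
      exacts [Or.inl .rfl, Or.inr .rfl]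
    · have hab : (T.deleteEdges {s(c, v)}).Adj b a := by
        rw [SimpleGraph.deleteEdges_adj]
        exact ⟨h.symm, by rwa [Set.mem_singleton_iff, Sym2.eq_swap]⟩
      exact ih.imp (fun h => h.trans hab.reachable) fun h => h.trans hab.reachable

theorem not_reachable_deleteEdges (hT : T.IsAcyclic) {u v : V} (huv : T.Adj u v) :
    ¬(T.deleteEdges {s(u, v)}).Reachable u v := by
  have := SimpleGraph.isAcyclic_iff_forall_adj_isBridge.mp hT huv
  rw [SimpleGraph.isBridge_iff] at this
  exact this

/-- A path that never meets `u` cannot use an edge at `u`. -/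
theorem reachable_deleteEdges_of_not_reachable {e : Sym2 V} {a u v x : V}
    (hx : (T.deleteEdges {e}).Reachable a x) (hu : ¬(T.deleteEdges {e}).Reachable a u) :
    (T.deleteEdges {s(u, v)}).Reachable a x := by
  classical
  obtain ⟨p⟩ := hx
  refine ⟨p.transfer _ fun e' he' => ?_⟩
  have h1 := p.edges_subset_edgeSet he'
  rw [SimpleGraph.edgeSet_deleteEdges] at h1 ⊢
  refine ⟨h1.1, fun h => hu ?_⟩
  rw [Set.mem_singleton_iff] at h
  subst h
  exact ⟨p.takeUntil u (p.fst_mem_support_of_mem_edges he')⟩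

theorem mem_or_of_sides (hT : T.IsTree) {u v : V} (huv : T.Adj u v) {I : Finset (Fin n)}
    (hI : ∀ i, i ∈ I ↔ (T.deleteEdges {s(u, v)}).Reachable u (leaf i)) (i : Fin n) :
    i ∈ Iᶜ ↔ (T.deleteEdges {s(u, v)}).Reachable v (leaf i) := by
  rw [Finset.mem_compl, hI]
  constructor
  · exact (reachable_deleteEdges_or hT.connected u v _).resolve_left
  · exact fun h h' => not_reachable_deleteEdges hT.isAcyclic huv (h'.trans h.symm)

theorem IsTreePartition.compl (hT : T.IsTree) {I : Finset (Fin n)}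
    (hI : IsTreePartition T leaf I) : IsTreePartition T leaf Iᶜ := by
  obtain ⟨u, v, huv, h⟩ := hI
  refine ⟨v, u, huv.symm, fun i => ?_⟩
  rw [Sym2.eq_swap]
  exact mem_or_of_sides hT huv h i

/-- Of two distinct edges, the second lies on one side of the first. The other side stays connected
when the second edge is deleted, so it falls into a single part of the second partition. -/
theorem IsTreePartition.crossFree (hT : T.IsTree) {I J : Finset (Fin n)}
    (hI : IsTreePartition T leaf I) (hJ : IsTreePartition T leaf J) :
    I ⊆ J ∨ J ⊆ I ∨ Disjoint I J ∨ I ∪ J = Finset.univ := by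
  obtain ⟨u, v, huv, hI⟩ := hI
  obtain ⟨u', v', huv', hJ⟩ := hJ
  have hI' := mem_or_of_sides hT huv hI
  have hJ' := mem_or_of_sides hT huv' hJ
  by_cases he : s(u, v) = s(u', v')
  · rcases Sym2.eq_iff.mp he with ⟨rfl, rfl⟩ | ⟨rfl, rfl⟩
    · exact Or.inl fun i hi => (hJ i).mpr ((hI i).mp hi)
    · refine Or.inr (Or.inr (Or.inl ?_))
      rw [Finset.disjoint_left]
      intro i hi
      rw [← Finset.mem_compl, hJ', Sym2.eq_swap]
      exact (hI i).mp hi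
  have hadj : (T.deleteEdges {s(u, v)}).Reachable u' v' := by
    refine SimpleGraph.Adj.reachable ?_
    rw [SimpleGraph.deleteEdges_adj]
    exact ⟨huv', fun h => he (Set.mem_singleton_iff.mp h).symm⟩
  rcases reachable_deleteEdges_or hT.connected u v u' with hu | hv
  · have hv' : ¬(T.deleteEdges {s(u, v)}).Reachable v u' := fun h =>
      not_reachable_deleteEdges hT.isAcyclic huv (hu.trans h.symm)
    have key : ∀ i ∈ Iᶜ, (T.deleteEdges {s(u', v')}).Reachable v (leaf i) := fun i hi =>
      reachable_deleteEdges_of_not_reachable ((hI' i).mp hi) hv'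
    rcases reachable_deleteEdges_or hT.connected u' v' v with h | h
    · refine Or.inr (Or.inr (Or.inr ?_))
      rw [Finset.eq_univ_iff_forall]
      intro i
      rw [Finset.mem_union, or_iff_not_imp_left]
      intro hi
      exact (hJ i).mpr (h.trans (key i (Finset.mem_compl.mpr hi)))
    · refine Or.inr (Or.inl ?_)
      rw [← Finset.compl_subset_compl]
      exact fun i hi => (hJ' i).mpr (h.trans (key i hi))
  · have hv' : ¬(T.deleteEdges {s(u, v)}).Reachable u u' := fun h =>
      not_reachable_deleteEdges hT.isAcyclic huv (h.trans hv.symm)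
    have key : ∀ i ∈ I, (T.deleteEdges {s(u', v')}).Reachable u (leaf i) := fun i hi =>
      reachable_deleteEdges_of_not_reachable ((hI i).mp hi) hv'
    rcases reachable_deleteEdges_or hT.connected u' v' u with h | h
    · exact Or.inl fun i hi => (hJ i).mpr (h.trans (key i hi))
    · refine Or.inr (Or.inr (Or.inl ?_))
      rw [Finset.disjoint_left]
      exact fun i hi => Finset.mem_compl.mp ((hJ' i).mpr (h.trans (key i hi)))

theorem IsLabeledTree.isTreePartition_singleton (h : IsLabeledTree T leaf) (i : Fin n) :
    IsTreePartition T leaf {i} := by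
  obtain ⟨v, hv⟩ := Set.ncard_eq_one.mp ((h.leaf_iff (leaf i)).mpr ⟨i, rfl⟩)
  have hadj : ∀ x, T.Adj (leaf i) x ↔ x = v := fun x => by
    rw [← SimpleGraph.mem_neighborSet, hv, Set.mem_singleton_iff]
  refine ⟨leaf i, v, (hadj v).mpr rfl, fun j => ?_⟩
  rw [Finset.mem_singleton]
  constructor
  · rintro rfl; exact .rfl
  · rintro ⟨p⟩
    refine h.leaf_injective ?_
    generalize hx : leaf j = x at p
    cases p with
    | nil => rfl
    | cons hab p =>
      rw [SimpleGraph.deleteEdges_adj, hadj] at hab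
      obtain ⟨rfl, hab⟩ := hab
      exact absurd rfl hab

end Graph

/-! ### Averages of cyclic weightings -/

section Main

theorem tilde_zero {G : Type*} [AddCommGroup G] [Fintype G] [DecidableEq G] (f : G → ℚ) :
    tilde f 0 = minVal f := if_pos rfl

theorem tilde_of_ne {G : Type*} [AddCommGroup G] [Fintype G] [DecidableEq G] (f : G → ℚ) {a : G}
    (ha : a ≠ 0) : tilde f a = f a := if_neg ha

theorem IsSymm.tilde {G : Type*} [AddCommGroup G] [Fintype G] [DecidableEq G] {f : G → ℚ}
    (hf : IsSymm f) : IsSymm (tilde f) := fun a => by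
  by_cases ha : a = 0
  · rw [ha, neg_zero]
  · rw [tilde_of_ne f ha, tilde_of_ne f (neg_ne_zero.mpr ha), hf]

theorem flow_avg {n : ℕ} {ι : Type*} (t : BTTree ι) (w : List ι → Weighting n)
    (I : Finset (Fin n)) : flow (fun e => t.avg fun l => w l e) I = t.avg fun l => flow (w l) I := by
  simp only [flow, BTTree.avg_sum]

variable {m n : ℕ} [NeZero m]

/-- If no label is zero, then the function `tilde f` is effective, by means of a weighting for which
the flow is prescribed across each member of a given cross-free family of partitions. -/
theorem exists_weighting_of_crossFree (hm : 3 ≤ m) {f : ZMod m → ℚ} (hf0 : f 0 = 0)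
    (hcyc : IsCyclicallyEffective f) (hnef : IsFNef f)
    (hQ : ∀ x : ZMod m → ℤ, x ≠ 0 → ∑ i, x i = 0 → minVal f ≤ quadForm f (fun i => (x i : ℚ)))
    (hn : 3 ≤ n) {d : Fin n → ZMod m} (hd : ∑ i, d i = 0) (hd0 : ∀ i, d i ≠ 0)
    {𝓣 : Set (Finset (Fin n))} (hcompl : ∀ I ∈ 𝓣, Iᶜ ∈ 𝓣)
    (hcross : ∀ I ∈ 𝓣, ∀ J ∈ 𝓣, I ⊆ J ∨ J ⊆ I ∨ Disjoint I J ∨ I ∪ J = Finset.univ)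
    (hsum : ∀ I ∈ 𝓣, ∑ i ∈ I, d i ≠ 0) :
    ∃ w : Weighting n, IsAdmissible (tilde f) d w ∧
      ∀ I ∈ 𝓣, flow w I = tilde f (∑ i ∈ I, d i) := by
  have : NeZero n := ⟨by omega⟩
  have : Fact (1 < m) := ⟨by omega⟩
  have hf := hcyc.1
  obtain ⟨r⟩ : Nonempty (Fin n) := ⟨0⟩
  have hsplit : ∀ I : Finset (Fin n), ∑ i ∈ Iᶜ, d i = -∑ i ∈ I, d i := fun I =>
    eq_neg_of_add_eq_zero_right (by rw [Finset.sum_add_sum_compl, hd])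
  -- Root at a label `r` and represent each partition by its part avoiding `r`. Two such parts
  -- cannot cover everything, so cross-freeness becomes laminarity. Singletons and the complement of
  -- `r` are added as leaves and top node.
  obtain ⟨t, hnd, hleaves, hgood, hblock⟩ := exists_tree_of_isLaminar (d := d)
    (S₀ := {r}ᶜ) (𝓕 := {F | r ∉ F ∧ (F ∈ 𝓣 ∨ (∃ i, F = {i}) ∨ F = {r}ᶜ)}) (by
      refine ⟨?_, ?_⟩
      · rintro F ⟨hr, hF⟩
        refine ⟨fun i hi => ?_, ?_⟩
        · rw [Finset.mem_compl, Finset.mem_singleton]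
          rintro rfl; exact hr hi
        · rcases hF with hF | ⟨i, rfl⟩ | rfl
          · exact hsum F hF
          · rw [Finset.sum_singleton]; exact hd0 i
          · rw [hsplit, Finset.sum_singleton]; exact neg_ne_zero.mpr (hd0 r)
      · have hsing : ∀ i (F : Finset (Fin n)), NestedOrDisjoint {i} F := fun i F => by
          by_cases hi : i ∈ F
          · exact Or.inl (Finset.singleton_subset_iff.mpr hi)
          · exact Or.inr (Or.inr (Finset.disjoint_singleton_left.mpr hi))
        have hmax : ∀ F : Finset (Fin n), r ∉ F → NestedOrDisjoint F {r}ᶜ := fun F hr =>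
          Or.inl fun i hi => by
            rw [Finset.mem_compl, Finset.mem_singleton]
            rintro rfl; exact hr hi
        rintro A ⟨hrA, hA⟩ B ⟨hrB, hB⟩
        rcases hA with hA | ⟨i, rfl⟩ | rfl
        · rcases hB with hB | ⟨i, rfl⟩ | rfl
          · rcases hcross A hA B hB with h | h | h | h
            · exact Or.inl h
            · exact Or.inr (Or.inl h)
            · exact Or.inr (Or.inr h)
            · exact absurd (h ▸ Finset.mem_univ r) (by simp [hrA, hrB])
          · exact (hsing i A).symm
          · exact hmax A hrA
        · exact hsing i B
        · exact (hmax B hrB).symm)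
    (fun i hi => ⟨by simpa [eq_comm] using hi, Or.inr (Or.inl ⟨i, rfl⟩)⟩)
    ⟨by simp, Or.inr (Or.inr rfl)⟩
  have hmemt : ∀ i, i ∈ t.leaves ↔ i ≠ r := fun i => by
    rw [← List.mem_toFinset, hleaves, Finset.mem_compl, Finset.mem_singleton]
  have hordn : ∀ l, t.IsOrder l → (r :: l).Nodup := fun l hl =>
    List.nodup_cons.mpr ⟨fun h => (hmemt r).mp (hl.perm.mem_iff.mp h) rfl, hl.perm.nodup_iff.mpr hnd⟩
  have hordm : ∀ l, t.IsOrder l → ∀ i, i ∈ r :: l := fun l hl i => by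
    rw [List.mem_cons, hl.perm.mem_iff, hmemt]
    exact em _
  -- The weighting is irrelevant for lists that are not orderings of the tree; `0` makes the choice
  -- total.
  have hex : ∀ l, ∃ w : Weighting n, t.IsOrder l → IsAdmissible f d w ∧
      ∀ l₁ l₂ l₃, r :: l = l₁ ++ l₂ ++ l₃ → flow w l₂.toFinset = f (l₂.map d).sum := fun l => by
    by_cases hl : t.IsOrder l
    · obtain ⟨w, hw⟩ := hcyc.exists_weighting hf0 hn hd (hordn l hl) (hordm l hl)
      exact ⟨w, fun _ => hw⟩
    · exact ⟨0, fun h => absurd h hl⟩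
  choose w hw using hex
  have hblockflow : ∀ S : Finset (Fin n), t.HasBlock S →
      flow (fun e => t.avg fun l => w l e) S = f (∑ i ∈ S, d i) := fun S hS => by
    rw [flow_avg, ← BTTree.avg_const t (f _)]
    refine BTTree.avg_congr fun l hl => ?_
    obtain ⟨l₁, l₂, l₃, e, rfl⟩ := hS.exists_segment hl
    rw [(hw l hl).2 (r :: l₁) l₂ l₃ (by simp [e]), List.sum_toFinset]
    have := (hordn l hl).of_cons
    rw [e] at this
    exact (List.nodup_append.mp (List.nodup_append.mp this).1).2.1
  refine ⟨fun e => t.avg fun l => w l e, ⟨fun i => ?_, fun I hI => ?_⟩, fun I hI => ?_⟩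
  · rw [tilde_of_ne f (hd0 i), vertexFlow_eq_flow, flow_avg, ← BTTree.avg_const t (f (d i))]
    refine BTTree.avg_congr fun l hl => ?_
    rw [← vertexFlow_eq_flow, (hw l hl).1.1]
  · rw [flow_avg]
    by_cases h0 : ∑ i ∈ I, d i = 0
    swap
    · rw [tilde_of_ne f h0]
      exact BTTree.le_avg fun l hl => (hw l hl).1.2 I hI
    rw [h0, tilde_zero]
    have hmin0 := minVal_nonneg hf0 hnef
    -- Properness is used here: each part has a label other than `r`, so `I` splits the leaves of
    -- the tree.
    have hgt : ∀ A : Finset (Fin n), 2 ≤ A.card → ∃ i ∈ t.leaves, i ∈ A := fun A hA => by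
      obtain ⟨i, hi, hir⟩ := Finset.exists_mem_ne (by omega : 1 < A.card) r
      exact ⟨i, (hmemt i).mpr hir, hi⟩
    have key := minVal_le_avg_energyForm hf hf0 hmin0 (fun a b ha hb => two_mul_minVal_le f ha hb)
      (fun h hh h2 => minVal_le_of_two_torsion hf (by rw [ZMod.card]; omega) hh h2) hgood
      (I := I) ⟨hgt I hI.1, by simpa using hgt Iᶜ hI.2⟩ (chain d I 0 [r]) (0 + ([r].map d).sum)
    have e : ∀ l, chain d I 0 (r :: l) = chain d I 0 [r] + chain d I (0 + ([r].map d).sum) l :=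
      fun l => chain_append d I 0 [r] l
    simp only [← e] at key
    rw [BTTree.avg_congr fun l hl =>
      flow_eq_energyForm hf hd (hordn l hl) (hordm l hl) (hw l hl).2 I]
    refine key fun l hl hne => minVal_le_energyForm hQ _ (sum_chain _ _ _ _) ?_ hne
    rw [moment_chain, ← List.sum_toFinset _ (hordn l hl),
      Finset.eq_univ_iff_forall.mpr fun i => List.mem_toFinset.mpr (hordm l hl i),
      Finset.sum_ite_mem, Finset.univ_inter, h0]
  · rw [tilde_of_ne f (hsum I hI)]
    by_cases hr : r ∈ I
    · rw [← flow_compl, hblockflow _ (hblock _ ⟨by simpa using hr, Or.inl (hcompl I hI)⟩), hsplit, hf]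
    · exact hblockflow _ (hblock I ⟨hr, Or.inl hI⟩)

end Main

/-! ### Inserting a zero label -/

section InsertZero

variable {n : ℕ}

theorem flow_add (w w' : Weighting n) (I : Finset (Fin n)) :
    flow (w + w') I = flow w I + flow w' I := by
  simp only [flow, Pi.add_apply, Finset.sum_add_distrib]

theorem flow_smul (c : ℚ) (w : Weighting n) (I : Finset (Fin n)) :
    flow (c • w) I = c * flow w I := by
  simp only [flow, Pi.smul_apply, smul_eq_mul, Finset.mul_sum]

theorem flow_single {a b : Fin n} (I : Finset (Fin n)) :
    flow (Pi.single s(a, b) 1) I = if a ∈ I ↔ b ∈ I then 0 else 1 := by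
  have aux : ∀ {a b : Fin n}, a ∈ I → b ∉ I → flow (Pi.single s(a, b) 1) I = 1 := by
    intro a b ha hb
    unfold flow
    rw [Finset.sum_eq_single a, Finset.sum_eq_single b]
    · simp
    · intro j hj hjb
      refine Pi.single_eq_of_ne (fun e => ?_) _
      rcases Sym2.eq_iff.mp e with h | h
      exacts [hjb h.2, Finset.mem_compl.mp hj (h.2 ▸ ha)]
    · exact fun h => absurd (Finset.mem_compl.mpr hb) h
    · intro i hi hia
      refine Finset.sum_eq_zero fun j hj => Pi.single_eq_of_ne (fun e => ?_) _
      rcases Sym2.eq_iff.mp e with h | h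
      exacts [hia h.1, hb (h.1 ▸ hi)]
    · exact fun h => absurd ha h
  by_cases ha : a ∈ I <;> by_cases hb : b ∈ I
  · simp only [ha, hb, if_true]
    refine Finset.sum_eq_zero fun i hi => Finset.sum_eq_zero fun j hj =>
      Pi.single_eq_of_ne (fun e => Finset.mem_compl.mp hj ?_) _
    rcases Sym2.eq_iff.mp e with h | h
    exacts [h.2 ▸ hb, h.2 ▸ ha]
  · simp [ha, hb, aux ha hb]
  · rw [Sym2.eq_swap]; simp [ha, hb, aux hb ha]
  · simp only [ha, hb, if_true]
    refine Finset.sum_eq_zero fun i hi => Finset.sum_eq_zero fun j hj =>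
      Pi.single_eq_of_ne (fun e => ?_) _
    rcases Sym2.eq_iff.mp e with h | h
    exacts [ha (h.1 ▸ hi), hb (h.1 ▸ hi)]

/-- A weighting of the complete graph on the complement of a vertex, extended by zero. -/
noncomputable def extendWeighting (k : Fin (n + 1)) (w : Weighting n) : Weighting (n + 1) :=
  Function.extend (Sym2.map k.succAbove) w 0

theorem flow_extendWeighting (k : Fin (n + 1)) (w : Weighting n) (I : Finset (Fin n)) :
    flow (extendWeighting k w) (I.map k.succAboveEmb) = flow w I := by
  have hinj : Function.Injective (Sym2.map k.succAbove) :=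
    Sym2.map.injective Fin.succAbove_right_injective
  have hc : (I.map k.succAboveEmb)ᶜ = insert k (Iᶜ.map k.succAboveEmb) := by
    ext x
    rcases Fin.eq_self_or_eq_succAbove k x with rfl | ⟨j, rfl⟩
    · simp [Fin.succAbove_ne]
    · simp [Fin.succAbove_ne]
  have hk : k ∉ Iᶜ.map k.succAboveEmb := by simp [Fin.succAbove_ne]
  unfold flow
  rw [hc, Finset.sum_map]
  refine Finset.sum_congr rfl fun i _ => ?_
  rw [Finset.sum_insert hk, Finset.sum_map]
  have h0 : extendWeighting k w s(k.succAboveEmb i, k) = 0 := by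
    refine Function.extend_apply' _ _ _ ?_
    rintro ⟨e, he⟩
    have : k ∈ Sym2.map k.succAbove e := he ▸ Sym2.mem_mk_right _ _
    obtain ⟨x, -, hx⟩ := Sym2.mem_map.mp this
    exact Fin.succAbove_ne k x hx
  rw [h0, zero_add]
  exact Finset.sum_congr rfl fun j _ => hinj.extend_apply w 0 s(i, j)

theorem IsAdmissible.le_flow {G : Type*} [AddCommGroup G] {f : G → ℚ} (hf : IsSymm f)
    {d : Fin n → G} (hd : ∑ i, d i = 0) {w : Weighting n} (hw : IsAdmissible f d w)
    {I : Finset (Fin n)} (hI : I.Nonempty) (hI' : Iᶜ.Nonempty) :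
    f (∑ i ∈ I, d i) ≤ flow w I := by
  by_cases h1 : I.card = 1
  · obtain ⟨i, rfl⟩ := Finset.card_eq_one.mp h1
    rw [← vertexFlow_eq_flow, hw.1, Finset.sum_singleton]
  by_cases h2 : Iᶜ.card = 1
  · obtain ⟨i, hi⟩ := Finset.card_eq_one.mp h2
    have h := Finset.sum_add_sum_compl I d
    rw [hd, hi, Finset.sum_singleton] at h
    rw [← flow_compl, hi, ← vertexFlow_eq_flow, hw.1, eq_neg_of_add_eq_zero_left h, hf]
  have := hI.card_pos
  have := hI'.card_pos
  exact hw.2 I ⟨by omega, by omega⟩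

/-- A label zero can be inserted by subdividing an edge. -/
theorem EffectiveWrt.insert_zero {G : Type*} [AddCommGroup G] {f : G → ℚ} (hf : IsSymm f)
    (hf0 : 0 ≤ f 0) (hn : 2 ≤ n) {d : Fin (n + 1) → G} (hd : ∑ i, d i = 0) {k : Fin (n + 1)}
    (hk : d k = 0) (h : EffectiveWrt f fun j => d (k.succAbove j)) : EffectiveWrt f d := by
  obtain ⟨w, hw⟩ := h
  have hd' : ∑ j, d (k.succAbove j) = 0 := by
    rw [Fin.sum_univ_succAbove d k, hk, zero_add] at hd
    exact hd
  obtain ⟨p, q, hpq⟩ : ∃ p q : Fin n, p ≠ q :=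
    ⟨⟨0, by omega⟩, ⟨1, by omega⟩, by simp [Fin.ext_iff]⟩
  -- The new vertex `k` subdivides the edge `p ∼ q`: weight `f 0 / 2` is taken from this edge and
  -- put on both edges from `k`. A cut changes only if it separates `k` from both `p` and `q`, and
  -- then gains `f 0`.
  obtain ⟨W, hW⟩ : ∃ W : Weighting (n + 1), W = extendWeighting k w +
      (f 0 / 2) • (Pi.single s(k, k.succAbove p) 1 + Pi.single s(k, k.succAbove q) 1 +
        (-1 : ℚ) • Pi.single s(k.succAbove p, k.succAbove q) 1) := ⟨_, rfl⟩
  have hflow : ∀ I : Finset (Fin n), flow W (I.map k.succAboveEmb) =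
      flow w I + if p ∈ I ∧ q ∈ I then f 0 else 0 := by
    intro I
    simp only [hW, flow_add, flow_smul, flow_single, flow_extendWeighting]
    have hkI : k ∉ I.map k.succAboveEmb := by simp [Fin.succAbove_ne]
    have hp : k.succAbove p ∈ I.map k.succAboveEmb ↔ p ∈ I := by simp
    have hq : k.succAbove q ∈ I.map k.succAboveEmb ↔ q ∈ I := by simp
    simp only [hkI, hp, hq, false_iff]
    by_cases h1 : p ∈ I <;> by_cases h2 : q ∈ I <;> (simp [h1, h2]; try ring)
  have hmap : ∀ I : Finset (Fin (n + 1)), k ∉ I → ∃ I' : Finset (Fin n), I = I'.map k.succAboveEmb := by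
    intro I hI
    refine ⟨Finset.univ.filter fun j => k.succAbove j ∈ I, ?_⟩
    ext x
    rcases Fin.eq_self_or_eq_succAbove k x with rfl | ⟨j, rfl⟩
    · simp [hI, Fin.succAbove_ne]
    · simp
  have hle : ∀ I : Finset (Fin (n + 1)), k ∉ I → IsProper I → f (∑ i ∈ I, d i) ≤ flow W I := by
    intro I hI hp
    obtain ⟨I', rfl⟩ := hmap I hI
    have hc1 := hp.1
    have hc2 := hp.2
    rw [Finset.card_compl, Fintype.card_fin] at hc2
    rw [Finset.card_map] at hc1 hc2
    have := hw.le_flow hf hd' (I := I') (Finset.card_pos.mp (by omega))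
      (Finset.card_pos.mp (by rw [Finset.card_compl, Fintype.card_fin]; omega))
    rw [hflow, Finset.sum_map]
    refine this.trans (le_add_of_nonneg_right ?_)
    split_ifs
    exacts [hf0, le_rfl]
  refine ⟨W, fun i => ?_, fun I hI => ?_⟩
  · rw [vertexFlow_eq_flow]
    rcases Fin.eq_self_or_eq_succAbove k i with rfl | ⟨j, rfl⟩
    · have : ({i} : Finset (Fin (n + 1)))ᶜ = Finset.univ.map i.succAboveEmb := by
        ext x
        rcases Fin.eq_self_or_eq_succAbove i x with rfl | ⟨j, rfl⟩
        · simp [Fin.succAbove_ne]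
        · simp [Fin.succAbove_ne]
      rw [← flow_compl, this, hflow, flow_univ, hk]
      simp
    · have := hflow {j}
      rw [Finset.map_singleton] at this
      rw [← k.coe_succAboveEmb, this, ← vertexFlow_eq_flow, hw.1, if_neg, add_zero]
      · rfl
      · rintro ⟨h1, h2⟩
        exact hpq ((Finset.mem_singleton.mp h1).trans (Finset.mem_singleton.mp h2).symm)
  · by_cases hkI : k ∈ I
    · have h1 := hle Iᶜ (by simpa using hkI) ⟨hI.2, by rw [compl_compl]; exact hI.1⟩
      have h2 := Finset.sum_add_sum_compl I d
      rw [hd] at h2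
      rwa [eq_neg_of_add_eq_zero_right h2, hf, flow_compl] at h1
    · exact hle I hkI hI

/-- The degenerate case in which the removal of zero labels may end; there are no proper partitions.
-/
theorem effectiveWrt_two {G : Type*} [AddCommGroup G] {f : G → ℚ} (hf : IsSymm f)
    {d : Fin 2 → G} (hd : ∑ i, d i = 0) : EffectiveWrt f d := by
  refine ⟨fun _ => f (d 0), fun i => ?_, fun I hI => ?_⟩
  · have h : d 1 = -d 0 := eq_neg_of_add_eq_zero_right (by rwa [Fin.sum_univ_two] at hd)
    have h' : f (-d 0) = f (d 0) := hf _
    fin_cases i <;> simp [vertexFlow, h, h']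
  · have h1 := hI.1
    have h2 := hI.2
    rw [Finset.card_compl, Fintype.card_fin] at h2
    omega

end InsertZero

/-! ### Effectivity of the modified function and the main theorem -/

theorem effectiveWrt_tilde {m : ℕ} [NeZero m] (hm : 3 ≤ m) {f : ZMod m → ℚ} (hf0 : f 0 = 0)
    (hcyc : IsCyclicallyEffective f) (hnef : IsFNef f)
    (hQ : ∀ x : ZMod m → ℤ, x ≠ 0 → ∑ i, x i = 0 → minVal f ≤ quadForm f (fun i => (x i : ℚ)))
    {n : ℕ} (hn : 2 ≤ n) {d : Fin n → ZMod m} (hd : ∑ i, d i = 0) :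
    EffectiveWrt (tilde f) d := by
  have : Fact (1 < m) := ⟨by omega⟩
  induction n, hn using Nat.le_induction with
  | base => exact effectiveWrt_two hcyc.1.tilde hd
  | succ n hn ih =>
    -- Zero labels are removed one at a time; a tuple without them is covered by averaging, with no
    -- partition prescribed.
    by_cases h : ∃ k, d k = 0
    · obtain ⟨k, hk⟩ := h
      refine EffectiveWrt.insert_zero hcyc.1.tilde ?_ hn hd hk (ih ?_)
      · rw [tilde_zero]; exact minVal_nonneg hf0 hnef
      · rw [Fin.sum_univ_succAbove d k, hk, zero_add] at hd
        exact hd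
    · push Not at h
      obtain ⟨w, hw, -⟩ := exists_weighting_of_crossFree hm hf0 hcyc hnef hQ (by omega) hd h
        (𝓣 := ∅) (by simp) (by simp) (by simp)
      exact ⟨w, hw⟩

end M0n

theorem mainTheorem7 (m : ℕ) [NeZero m] (hm : 3 ≤ m) (f : ZMod m → ℚ) (hf0 : f 0 = 0)
    (hcyc : M0n.IsCyclicallyEffective f) (hnef : M0n.IsFNef f)
    (hQ : ∀ x : ZMod m → ℤ, x ≠ 0 → ∑ i, x i = 0 →
      M0n.minVal f ≤ M0n.quadForm f (fun i => (x i : ℚ))) :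
    M0n.IsEffective (M0n.tilde f) ∧
    ∀ (n : ℕ), 3 ≤ n → ∀ d : Fin n → ZMod m, ∑ i, d i = 0 →
      ∀ (V : Type*) (T : SimpleGraph V) (leaf : Fin n → V), M0n.IsLabeledTree T leaf →
        (∀ I, M0n.IsTreePartition T leaf I → ∑ i ∈ I, d i ≠ 0) →
          M0n.TreeEffectiveWrt T leaf (M0n.tilde f) d := by
  refine ⟨⟨hcyc.1.tilde, fun n hn d hd =>
    M0n.effectiveWrt_tilde hm hf0 hcyc hnef hQ (by omega) hd⟩, ?_⟩
  intro n hn d hd V T leaf hT hne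
  refine M0n.exists_weighting_of_crossFree hm hf0 hcyc hnef hQ hn hd (fun i => ?_)
    (𝓣 := {I | M0n.IsTreePartition T leaf I}) (fun I hI => hI.compl hT.isTree)
    (fun I hI J hJ => hI.crossFree hT.isTree hJ) hne
  -- The edges at leaves are included in the hypothesis on `T`-partitions, so no label is zero.
  have := hne _ (hT.isTreePartition_singleton i)
  rwa [Finset.sum_singleton] at this
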